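/- Let $\mathsf k$ be a commutative ring with unit and let $Q$ be a finite quiver without oriented cycles, with vertex set $Q_0$. In the path algebra $\mathsf kQ$ the product $pq$ of two paths is the concatenation "first $p$, then $q$" if the head of $p$ is the tail of $q$, and $0$ otherwise; write $t(p)$, $h(p)$ for the tail (start) and head (end) of a path $p$, and $e_v$ for the trivial path at $v\in Q_0$. For every pair of vertices $(v,w)$ let a (possibly empty) collection of pairwise disjoint sets of paths from $v$ to $w$ be given, and let $I\subset \mathsf kQ$ be the two-sided ideal generated by all differences $p-p'$ of paths $p,p'$ lying in a common one of these sets. Assume that $A=\mathsf kQ/I$ is a homotopy path algebra (HPA), i.e. that for all paths $r,p,p'$: - if $rp-rp'$ is nonzero and lies in $I$, then $p-p'\in I$; - if $pr-p'r$ is nonzero and lies in $I$, then $p-p'\in I$. Let $\mathrm{Path}_A$ be the set of paths of $Q$ modulo the equivalence relation that identifies two paths $p,q$ with the same tail and the same head when $p-q\in I$, partially ordered by $[p]\le [q]$ iff $[q]=[pr]$ for some path $r$. For a vertex $v$ let $S_v$ be the $\mathsf k$-module $\mathsf k$, viewed as a left or as a right $A$-module on which $e_v$ acts as the identity and every other path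 acts as zero. For $p\in \mathrm{Path}_A$ with $t(p)=v$ let $K((e_v,p))$ be the order complex of the open interval $(e_v,p)$ in $\mathrm{Path}_A$, and let $\widetilde H_j$ denote reduced simplicial homology with coefficients in $\mathsf k$ (the empty set being a simplex of dimension $-1$ of every complex, including the empty one, so that $\widetilde H_{-1}(\emptyset)=\mathsf k$ and $\widetilde H_j(\emptyset)=0$ for $j\ge 0$). Then for all vertices $v,w\in Q_0$ and every integer $i\geq 2$ there is an isomorphism of $\mathsf k$-modules $$ \mathrm{Tor}^A_i(S_v, S_w)\;\cong \bigoplus_{p\in \mathrm{Path}_A,\ t(p)=v,\ h(p)=w} \widetilde H_{i-2}\bigl(K((e_v,p))\bigr), $$ where $S_v$ is taken as a right and $S_w$ as a left $A$-module. -/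

import Mathlib

universe u v w

noncomputable section

namespace HomotopyPath

/-! ### Quivers and path algebras -/

/-- A quiver is acyclic if every path from a vertex to itself is trivial. -/
class AcyclicQuiver (Q : Type v) [Quiver.{w} Q] : Prop where
  eq_nil : ∀ (a : Q) (p : Quiver.Path a a), p = Quiver.Path.nil

/-- The type of all paths of a quiver: a path `⟨a, b, p⟩` has tail (source) `a` and head
(target) `b`. -/
abbrev AllPaths (Q : Type v) [Quiver.{w} Q] : Type (max v w) :=
  Σ a : Q, Σ b : Q, Quiver.Path a b

/-- The path algebra `kQ`: the free `k`-module on the set of all paths. -/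
def PathAlgebra (k : Type u) [CommRing k] (Q : Type v) [Quiver.{w} Q] : Type (max u v w) :=
  AllPaths Q →₀ k

namespace PathAlgebra

variable (k : Type u) [CommRing k] {Q : Type v} [Quiver.{w} Q]

instance : AddCommGroup (PathAlgebra k Q) := inferInstanceAs (AddCommGroup (AllPaths Q →₀ k))

instance : Module k (PathAlgebra k Q) := inferInstanceAs (Module k (AllPaths Q →₀ k))

/-- The basis element of `kQ` given by a path. -/
def single (p : AllPaths Q) : PathAlgebra k Q := Finsupp.single p (1 : k)

/-- The basis element of `kQ` given by a path with prescribed end points. -/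
abbrev of {a b : Q} (p : Quiver.Path a b) : PathAlgebra k Q := single k ⟨a, b, p⟩

open Classical in
/-- The product of two paths `p`, `q` in `kQ`: the concatenation "first `p`, then `q`" if the
head of `p` is the tail of `q`, and zero otherwise. -/
def mulBasis (p q : AllPaths Q) : PathAlgebra k Q :=
  if h : q.1 = p.2.1 then of k (p.2.2.comp (q.2.2.cast h rfl)) else 0

/-- The bilinear extension of the product of paths. -/
def mulHom : PathAlgebra k Q →ₗ[k] PathAlgebra k Q →ₗ[k] PathAlgebra k Q :=
  Finsupp.linearCombination k fun p : AllPaths Q =>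
    (Finsupp.linearCombination k fun q : AllPaths Q => mulBasis k p q :
      (AllPaths Q →₀ k) →ₗ[k] PathAlgebra k Q)

instance : Mul (PathAlgebra k Q) := ⟨fun f g => mulHom k f g⟩

/-- The unit of `kQ` is the sum of the trivial paths. -/
instance [Fintype Q] : One (PathAlgebra k Q) :=
  ⟨∑ a : Q, of k (Quiver.Path.nil : Quiver.Path a a)⟩

variable {k}

theorem mul_def (f g : PathAlgebra k Q) : f * g = mulHom k f g := rfl

theorem one_def [Fintype Q] :
    (1 : PathAlgebra k Q) = ∑ a : Q, of k (Quiver.Path.nil : Quiver.Path a a) := rfl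

theorem single_mul_single (p q : AllPaths Q) :
    single k p * single k q = mulBasis k p q := by
  have h1 : mulHom k (single k p) =
      (Finsupp.linearCombination k fun q : AllPaths Q => mulBasis k p q :
        (AllPaths Q →₀ k) →ₗ[k] PathAlgebra k Q) :=
    (Finsupp.linearCombination_single k (1 : k) p).trans (one_smul _ _)
  rw [mul_def, h1]
  exact (Finsupp.linearCombination_single k (1 : k) q).trans (one_smul _ _)

theorem of_mul_of {a b c : Q} (p : Quiver.Path a b) (q : Quiver.Path b c) :
    of k p * of k q = of k (p.comp q) := by
  rw [single_mul_single]
  simp [mulBasis]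

theorem single_mul_single_of_ne (p q : AllPaths Q) (h : q.1 ≠ p.2.1) :
    single k p * single k q = 0 := by
  rw [single_mul_single]
  simp [mulBasis, h]

theorem induction {motive : PathAlgebra k Q → Prop} (f : PathAlgebra k Q)
    (zero : motive 0) (add : ∀ f g, motive f → motive g → motive (f + g))
    (smul : ∀ (c : k) (p : AllPaths Q), motive (c • single k p)) : motive f := by
  refine Finsupp.induction_linear (motive := motive) f zero add fun p c => ?_
  have h : c • single k p = (Finsupp.single p c : AllPaths Q →₀ k) :=
    (Finsupp.smul_single c p (1 : k)).trans (by rw [smul_eq_mul, mul_one])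
  exact h ▸ smul c p

protected theorem mul_add' (f g h : PathAlgebra k Q) : f * (g + h) = f * g + f * h := by
  simp [mul_def]

protected theorem add_mul' (f g h : PathAlgebra k Q) : (f + g) * h = f * h + g * h := by
  simp [mul_def]

protected theorem zero_mul' (f : PathAlgebra k Q) : 0 * f = 0 := by
  simp [mul_def]

protected theorem mul_zero' (f : PathAlgebra k Q) : f * 0 = 0 := by
  simp [mul_def]

protected theorem smul_mul' (c : k) (f g : PathAlgebra k Q) : (c • f) * g = c • (f * g) := by
  simp [mul_def]

protected theorem mul_smul' (c : k) (f g : PathAlgebra k Q) : f * (c • g) = c • (f * g) := by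
  simp [mul_def]

theorem single_mul_assoc (p q r : AllPaths Q) :
    single k p * single k q * single k r = single k p * (single k q * single k r) := by
  obtain ⟨a, b, p⟩ := p
  obtain ⟨c, d, q⟩ := q
  obtain ⟨e, f, r⟩ := r
  by_cases h : c = b
  · subst h
    by_cases h' : e = d
    · subst h'
      simp only [of_mul_of, Quiver.Path.comp_assoc]
    · rw [of_mul_of, single_mul_single_of_ne _ _ h', single_mul_single_of_ne _ _ h',
        PathAlgebra.mul_zero']
  · rw [single_mul_single_of_ne _ _ h, PathAlgebra.zero_mul']
    by_cases h' : e = d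
    · subst h'
      rw [of_mul_of, single_mul_single_of_ne _ _ h]
    · rw [single_mul_single_of_ne ⟨c, d, q⟩ _ h', PathAlgebra.mul_zero']

protected theorem mul_assoc' (f g h : PathAlgebra k Q) : f * g * h = f * (g * h) := by
  induction f using induction with
  | zero => simp only [PathAlgebra.zero_mul']
  | add f f' hf hf' => simp only [PathAlgebra.add_mul', hf, hf']
  | smul c p =>
    induction g using induction with
    | zero => simp only [PathAlgebra.zero_mul', PathAlgebra.mul_zero']
    | add f f' hf hf' => simp only [PathAlgebra.add_mul', PathAlgebra.mul_add', hf, hf']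
    | smul c' q =>
      induction h using induction with
      | zero => simp only [PathAlgebra.mul_zero']
      | add f f' hf hf' => simp only [PathAlgebra.mul_add', hf, hf']
      | smul c'' r =>
        simp only [PathAlgebra.smul_mul', PathAlgebra.mul_smul', single_mul_assoc]

protected theorem one_mul' [Fintype Q] (f : PathAlgebra k Q) : 1 * f = f := by
  induction f using induction with
  | zero => simp only [PathAlgebra.mul_zero']
  | add f f' hf hf' => simp only [PathAlgebra.mul_add', hf, hf']
  | smul c p =>
    obtain ⟨a, b, p⟩ := p
    rw [PathAlgebra.mul_smul', one_def, mul_def, map_sum, LinearMap.sum_apply,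
      Finset.sum_eq_single a]
    · rw [← mul_def, of_mul_of, Quiver.Path.nil_comp]
    · intro d _ hd
      rw [← mul_def, single_mul_single_of_ne _ _ (Ne.symm hd)]
    · simp

protected theorem mul_one' [Fintype Q] (f : PathAlgebra k Q) : f * 1 = f := by
  induction f using induction with
  | zero => simp only [PathAlgebra.zero_mul']
  | add f f' hf hf' => simp only [PathAlgebra.add_mul', hf, hf']
  | smul c p =>
    obtain ⟨a, b, p⟩ := p
    rw [PathAlgebra.smul_mul', one_def, mul_def, map_sum, Finset.sum_eq_single b]
    · rw [← mul_def, of_mul_of, Quiver.Path.comp_nil]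
    · intro d _ hd
      rw [← mul_def, single_mul_single_of_ne _ _ hd]
    · simp

instance [Fintype Q] : Ring (PathAlgebra k Q) where
  __ := (inferInstance : AddCommGroup (PathAlgebra k Q))
  mul_assoc := PathAlgebra.mul_assoc'
  one_mul := PathAlgebra.one_mul'
  mul_one := PathAlgebra.mul_one'
  left_distrib := PathAlgebra.mul_add'
  right_distrib := PathAlgebra.add_mul'
  zero_mul := PathAlgebra.zero_mul'
  mul_zero := PathAlgebra.mul_zero'

instance [Fintype Q] : Algebra k (PathAlgebra k Q) :=
  Algebra.ofModule PathAlgebra.smul_mul' PathAlgebra.mul_smul'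

/-- The coefficient of a path in an element of `kQ`. -/
def coeff (p : AllPaths Q) : PathAlgebra k Q →ₗ[k] k := Finsupp.lapply p

open Classical in
theorem coeff_single (p q : AllPaths Q) :
    coeff p (single k q) = if q = p then 1 else 0 := by
  exact Finsupp.single_apply

/-- The trivial path `e_a` at a vertex `a`. -/
abbrev trivialPath (a : Q) : AllPaths Q := ⟨a, a, Quiver.Path.nil⟩

theorem coeff_trivialPath_mul (a : Q) (f g : PathAlgebra k Q) :
    coeff (trivialPath a) (f * g) = coeff (trivialPath a) f * coeff (trivialPath a) g := by
  induction f using induction with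
  | zero => simp only [PathAlgebra.zero_mul', map_zero, zero_mul]
  | add f f' hf hf' => simp only [PathAlgebra.add_mul', map_add, add_mul, hf, hf']
  | smul c p =>
    induction g using induction with
    | zero => simp only [PathAlgebra.mul_zero', map_zero, mul_zero]
    | add f f' hf hf' => simp only [PathAlgebra.mul_add', map_add, mul_add, hf, hf']
    | smul c' q =>
      simp only [PathAlgebra.smul_mul', PathAlgebra.mul_smul', map_smul, smul_eq_mul]
      have key : coeff (trivialPath a) (single k p * single k q) =
          coeff (trivialPath a) (single k p) * coeff (trivialPath a) (single k q) := by
        obtain ⟨b, c, p⟩ := p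
        obtain ⟨d, e, q⟩ := q
        by_cases h : d = c
        · subst h
          rw [of_mul_of]
          cases q with
          | nil =>
            cases p with
            | nil =>
              by_cases hb : b = a
              · subst hb; simp [coeff_single]
              · simp [coeff_single, hb]
            | cons p x =>
              have h1 : ∀ {b c d : Q} (p : Quiver.Path b c) (x : c ⟶ d),
                  (⟨b, d, p.cons x⟩ : AllPaths Q) ≠ trivialPath a := by
                intro b c d p x h
                obtain ⟨rfl, h⟩ := Sigma.mk.inj_iff.1 h
                obtain ⟨rfl, h⟩ := Sigma.mk.inj_iff.1 (eq_of_heq h)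
                exact Quiver.Path.cons_ne_nil _ _ (eq_of_heq h)
              simp [coeff_single, h1 p x]
          | cons q x =>
            have h1 : ∀ {b c d : Q} (p : Quiver.Path b c) (x : c ⟶ d),
                (⟨b, d, p.cons x⟩ : AllPaths Q) ≠ trivialPath a := by
              intro b c d p x h
              obtain ⟨rfl, h⟩ := Sigma.mk.inj_iff.1 h
              obtain ⟨rfl, h⟩ := Sigma.mk.inj_iff.1 (eq_of_heq h)
              exact Quiver.Path.cons_ne_nil _ _ (eq_of_heq h)
            simp [coeff_single, h1 q x, h1 (p.comp q) x]
        · rw [single_mul_single_of_ne _ _ h, map_zero, coeff_single, coeff_single]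
          split_ifs with h1 h2
          · exfalso
            apply h
            obtain ⟨rfl, h1⟩ := Sigma.mk.inj_iff.1 h1
            obtain ⟨rfl, h1⟩ := Sigma.mk.inj_iff.1 (eq_of_heq h1)
            obtain ⟨rfl, h2⟩ := Sigma.mk.inj_iff.1 h2
            rfl
          all_goals simp
      rw [key]
      ring

theorem coeff_trivialPath_one [Fintype Q] (a : Q) :
    coeff (trivialPath a) (1 : PathAlgebra k Q) = 1 := by
  rw [one_def, map_sum, Finset.sum_eq_single a]
  · simp [coeff_single]
  · intro b _ hb
    rw [coeff_single, if_neg]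
    intro h
    exact hb (Sigma.mk.inj_iff.1 h).1
  · simp

/-- The ring homomorphism `kQ → k` sending `e_a` to `1` and every other path to `0`. -/
def evalVertex [Fintype Q] (a : Q) : PathAlgebra k Q →+* k where
  toFun := coeff (trivialPath a)
  map_one' := coeff_trivialPath_one a
  map_mul' := coeff_trivialPath_mul a
  map_zero' := map_zero _
  map_add' := map_add _

end PathAlgebra

open PathAlgebra

/-! ### Homotopy path algebras -/

/-- For a collection `S a b` of sets of paths from `a` to `b`, for all vertices `a, b`, the
two-sided ideal `I_S` of `kQ` generated by all `p - p'` with `p`, `p'` in a common member of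
some `S a b`. -/
def relationIdeal (k : Type u) [CommRing k] {Q : Type v} [Quiver.{w} Q] [Fintype Q]
    (S : ∀ a b : Q, Set (Set (Quiver.Path a b))) : TwoSidedIdeal (PathAlgebra k Q) :=
  TwoSidedIdeal.span
    {x | ∃ (a b : Q), ∃ T ∈ S a b, ∃ p ∈ T, ∃ p' ∈ T, x = of k p - of k p'}

/-- The data defining a homotopy path algebra over `k` on the quiver `Q`: for all vertices `a, b`
a collection of pairwise disjoint sets of paths from `a` to `b`, such that the ideal `I_S`
allows cancellation of paths on the left and on the right. -/
structure HPA (k : Type u) [CommRing k] (Q : Type v) [Quiver.{w} Q] [Fintype Q] where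
  rel : ∀ a b : Q, Set (Set (Quiver.Path a b))
  disjoint : ∀ a b : Q, (rel a b).PairwiseDisjoint id
  left_cancel : ∀ r p p' : AllPaths Q,
    single k r * single k p - single k r * single k p' ≠ 0 →
    single k r * single k p - single k r * single k p' ∈ relationIdeal k rel →
    single k p - single k p' ∈ relationIdeal k rel
  right_cancel : ∀ r p p' : AllPaths Q,
    single k p * single k r - single k p' * single k r ≠ 0 →
    single k p * single k r - single k p' * single k r ∈ relationIdeal k rel →
    single k p - single k p' ∈ relationIdeal k rel

namespace HPA

variable {k : Type u} [CommRing k] {Q : Type v} [Quiver.{w} Q] [Fintype Q] (H : HPA k Q)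

/-- The ideal `I_S`. -/
abbrev ideal : TwoSidedIdeal (PathAlgebra k Q) := relationIdeal k H.rel

/-- The algebra `A = kQ / I_S`. -/
def Alg : Type (max u v w) := H.ideal.ringCon.Quotient

instance : Ring H.Alg := inferInstanceAs (Ring H.ideal.ringCon.Quotient)

instance : Algebra k H.Alg := inferInstanceAs (Algebra k H.ideal.ringCon.Quotient)

/-- The quotient map `kQ → A`. -/
def toAlg : PathAlgebra k Q →+* H.Alg := H.ideal.ringCon.mk'

/-- Parallel paths `p`, `q` are equivalent if `p - q ∈ I_S`. -/
def pathSetoid (a b : Q) : Setoid (Quiver.Path a b) where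
  r p q := of k p - of k q ∈ H.ideal
  iseqv :=
    { refl := fun p => by rw [sub_self]; exact zero_mem _
      symm := fun {p q} h => by rw [← neg_sub]; exact neg_mem h
      trans := fun {p q r} h h' => by
        rw [← sub_add_sub_cancel _ (of k q) _]; exact add_mem h h' }

/-- The set of paths of `A` from `a` to `b`, i.e. of classes of paths of `Q` modulo `I_S`. -/
def PathClass (a b : Q) : Type (max v w) := Quotient (H.pathSetoid a b)

/-- The path poset `Path_A`: all paths of `A`, with their end points. -/
structure Paths : Type (max v w) where
  tail : Q
  head : Q
  cls : H.PathClass tail head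

/-- The element of `Path_A` represented by a path of `Q`. -/
def pathMk {a b : Q} (p : Quiver.Path a b) : H.Paths := ⟨a, b, Quotient.mk (H.pathSetoid a b) p⟩

/-- The trivial path `e_a` in `Path_A`. -/
def idPath (a : Q) : H.Paths := H.pathMk (Quiver.Path.nil : Quiver.Path a a)

theorem pathMk_comp_eq {a b c a' b' : Q} {p : Quiver.Path a b} {p' : Quiver.Path a' b'}
    (h : H.pathMk p = H.pathMk p') (r : Quiver.Path b' c) :
    ∃ s : Quiver.Path b c, H.pathMk (p.comp s) = H.pathMk (p'.comp r) := by
  obtain ⟨rfl, rfl, h⟩ := (Paths.mk.injEq ..).mp h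
  refine ⟨r, ?_⟩
  have h' : of k p - of k p' ∈ H.ideal := Quotient.exact (s := H.pathSetoid a b) (eq_of_heq h)
  have : Quotient.mk (H.pathSetoid a c) (p.comp r) =
      Quotient.mk (H.pathSetoid a c) (p'.comp r) := by
    apply Quotient.sound
    change of k (p.comp r) - of k (p'.comp r) ∈ H.ideal
    rw [← of_mul_of, ← of_mul_of, ← sub_mul]
    exact TwoSidedIdeal.mul_mem_right _ _ _ h'
  simp only [pathMk, this]

/-- The order of `Path_A`: `x ≤ y` if `y = x r` for some path `r`. -/
instance [AcyclicQuiver Q] : PartialOrder H.Paths where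
  le x y := ∃ (a b c : Q) (p : Quiver.Path a b) (r : Quiver.Path b c),
    x = H.pathMk p ∧ y = H.pathMk (p.comp r)
  le_refl := by
    rintro ⟨a, b, x⟩
    induction x using Quotient.inductionOn with
    | h p => exact ⟨a, b, b, p, Quiver.Path.nil, rfl, rfl⟩
  le_trans := by
    rintro x y z ⟨a, b, c, p, r, rfl, rfl⟩ ⟨a', b', c', p', r', h, rfl⟩
    obtain ⟨s, hs⟩ := H.pathMk_comp_eq h r'
    exact ⟨a, b, c', p, r.comp s, rfl, by rw [← hs, Quiver.Path.comp_assoc]⟩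
  le_antisymm := by
    rintro x y ⟨a, b, c, p, r, rfl, rfl⟩ ⟨a', b', c', p', r', h, h'⟩
    have h1 : b' = c := (congrArg Paths.head h).symm
    have h2 : c' = b := (congrArg Paths.head h').symm
    subst h1 h2
    have h3 := congrArg Quiver.Path.length (AcyclicQuiver.eq_nil c' (r.comp r'))
    rw [Quiver.Path.length_comp, Quiver.Path.length_nil] at h3
    have h4 : r.length = 0 := by omega
    cases r with
    | nil => rfl
    | cons r x => simp at h4

/-- The ring homomorphism `A → k` sending `e_a` to `1` and every other path to `0`. It is well
defined since `Q` is acyclic. -/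
def evalVertex [AcyclicQuiver Q] (a : Q) : H.Alg →+* k :=
  RingCon.lift H.ideal.ringCon (PathAlgebra.evalVertex a) (by
    have hI : H.ideal ≤ TwoSidedIdeal.ker (PathAlgebra.evalVertex (k := k) a) := by
      refine TwoSidedIdeal.span_le.2 ?_
      rintro _ ⟨b, c, T, -, p, -, p', -, rfl⟩
      refine (TwoSidedIdeal.mem_ker _).2 ?_
      rw [map_sub, sub_eq_zero]
      change coeff (trivialPath a) (of k p) = coeff (trivialPath a) (of k p')
      rw [coeff_single, coeff_single]
      have key : ∀ p p' : Quiver.Path b c, (⟨b, c, p⟩ : AllPaths Q) = trivialPath a →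
          (⟨b, c, p'⟩ : AllPaths Q) = trivialPath a := by
        intro p p' h
        obtain ⟨rfl, h⟩ := Sigma.mk.inj_iff.1 h
        obtain ⟨rfl, h⟩ := Sigma.mk.inj_iff.1 (eq_of_heq h)
        rw [AcyclicQuiver.eq_nil _ p']
      by_cases h : (⟨b, c, p⟩ : AllPaths Q) = trivialPath a
      · rw [if_pos h, if_pos (key p p' h)]
      · rw [if_neg h, if_neg fun h' => h (key p' p h')]
    intro x y hxy
    have h := hI (((TwoSidedIdeal.rel_iff _ _ _).1 hxy : x - y ∈ H.ideal))
    rw [TwoSidedIdeal.mem_ker, map_sub, sub_eq_zero] at h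
    exact h)

theorem evalVertex_toAlg [AcyclicQuiver Q] (a : Q) (f : PathAlgebra k Q) :
    H.evalVertex a (H.toAlg f) = coeff (trivialPath a) f := rfl

/-- The simple module `S_a` at the vertex `a`: the `k`-module `k`, on which `e_a` acts as the
identity and all other paths act as zero. It is a left and a right module over `A`. (The
universe lift only serves to make it live in the universe of `A`.) -/
def Simple {k : Type u} [CommRing k] {Q : Type v} [Quiver.{w} Q] [Fintype Q] (_H : HPA k Q)
    (_a : Q) : Type (max u v w) := ULift.{max v w} k

variable (a : Q)

instance : AddCommGroup (H.Simple a) := inferInstanceAs (AddCommGroup (ULift.{max v w} k))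

instance : Module k (H.Simple a) := inferInstanceAs (Module k (ULift.{max v w} k))

instance [AcyclicQuiver Q] : Module H.Alg (H.Simple a) :=
  Module.compHom (H.Simple a) (H.evalVertex a)

instance [AcyclicQuiver Q] : Module H.Algᵐᵒᵖ (H.Simple a) :=
  Module.compHom (H.Simple a) ((H.evalVertex a).fromOpposite fun _ _ => mul_comm _ _)

theorem simple_smul_def [AcyclicQuiver Q] (x : H.Alg) (s : H.Simple a) :
    x • s = H.evalVertex a x • s := rfl

theorem simple_op_smul_def [AcyclicQuiver Q] (x : H.Alg) (s : H.Simple a) :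
    MulOpposite.op x • s = H.evalVertex a x • s := rfl

instance [AcyclicQuiver Q] : SMulCommClass k H.Algᵐᵒᵖ (H.Simple a) where
  smul_comm c x s := by
    induction x using MulOpposite.rec' with
    | h x => rw [simple_op_smul_def, simple_op_smul_def, smul_comm]

end HPA

/-! ### Tensor products and `Tor` over a noncommutative ring -/

section Tor

open TensorProduct CategoryTheory

variable (k : Type u) [CommRing k] (A : Type v) [Ring A]

section

variable (N : Type w) [AddCommGroup N] [Module k N] [Module Aᵐᵒᵖ N] [SMulCommClass k Aᵐᵒᵖ N]

/-- The submodule of `N ⊗ M` generated by the elements `n a ⊗ m - n ⊗ a m`. -/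
def balancing (M : Type*) [AddCommGroup M] [Module A M] : Submodule k (N ⊗[ℤ] M) :=
  Submodule.span k {x | ∃ (n : N) (a : A) (m : M),
    x = (MulOpposite.op a • n) ⊗ₜ[ℤ] m - n ⊗ₜ[ℤ] (a • m)}

/-- The tensor product `N ⊗_A M` of a right `A`-module `N` (with a commuting `k`-module
structure) and a left `A`-module `M`, as a `k`-module. -/
abbrev TensorOver (M : Type*) [AddCommGroup M] [Module A M] : Type _ :=
  (N ⊗[ℤ] M) ⧸ balancing k A N M

/-- The functoriality of `N ⊗_A M` in `M`. -/
def TensorOver.map {M M' : Type*} [AddCommGroup M] [Module A M] [AddCommGroup M'] [Module A M']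
    (f : M →ₗ[A] M') : TensorOver k A N M →ₗ[k] TensorOver k A N M' :=
  Submodule.mapQ (balancing k A N M) (balancing k A N M')
    (TensorProduct.AlgebraTensorModule.lTensor k N (f.restrictScalars ℤ)) (by
      refine Submodule.span_le.2 ?_
      rintro _ ⟨n, a, m, rfl⟩
      refine Submodule.subset_span ⟨n, a, f m, ?_⟩
      simp)

theorem TensorOver.map_mk_tmul {M M' : Type*} [AddCommGroup M] [Module A M] [AddCommGroup M']
    [Module A M'] (f : M →ₗ[A] M') (n : N) (m : M) :
    TensorOver.map k A N f (Submodule.Quotient.mk (n ⊗ₜ[ℤ] m)) =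
      Submodule.Quotient.mk (n ⊗ₜ[ℤ] f m) := rfl

theorem TensorOver.hom_ext {M X : Type*} [AddCommGroup M] [Module A M] [AddCommGroup X]
    [Module k X] {f g : TensorOver k A N M →ₗ[k] X}
    (h : ∀ n m, f (Submodule.Quotient.mk (n ⊗ₜ[ℤ] m)) = g (Submodule.Quotient.mk (n ⊗ₜ[ℤ] m))) :
    f = g := by
  apply LinearMap.ext
  intro x
  obtain ⟨x, rfl⟩ := Submodule.Quotient.mk_surjective _ x
  induction x using TensorProduct.induction_on with
  | zero => simp
  | tmul n m => exact h n m
  | add x y hx hy => rw [Submodule.Quotient.mk_add, map_add, map_add, hx, hy]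

/-- The functor `N ⊗_A -` from left `A`-modules to `k`-modules. -/
def tensorFunctor : ModuleCat.{max v w} A ⥤ ModuleCat.{max v w} k where
  obj M := ModuleCat.of k (TensorOver k A N M)
  map f := ModuleCat.ofHom (TensorOver.map k A N f.hom)
  map_id M := by
    ext : 1
    exact TensorOver.hom_ext k A N fun n m => rfl
  map_comp f g := by
    ext : 1
    exact TensorOver.hom_ext k A N fun n m => rfl

instance : (tensorFunctor k A N).Additive where
  map_add {M M' f g} := by
    ext : 1
    refine TensorOver.hom_ext k A N fun n m => ?_
    exact (congrArg (Submodule.Quotient.mk (p := balancing k A N M'))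
      (TensorProduct.tmul_add n (f.hom m) (g.hom m))).trans (Submodule.Quotient.mk_add _)

/-- `Tor_i^A(N, M)`: the `i`-th left derived functor of `N ⊗_A -`, evaluated at `M`. -/
def TorOver (i : ℕ) (M : ModuleCat.{max v w} A) : ModuleCat.{max v w} k :=
  ((tensorFunctor k A N).leftDerived i).obj M

end

end Tor

/-! ### Reduced homology of the order complex of a poset -/

section OrderComplex

variable (k : Type u) [CommRing k] (P : Type v) [PartialOrder P]

/-- The reduced simplicial chains of the order complex of `P` on simplices with `m` vertices: the
free `k`-module on the chains `x_0 < ⋯ < x_{m-1}` of `P`. For `m = 0` this is `k`, generated by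
the empty simplex. -/
abbrev ReducedChains (m : ℕ) : Type (max u v) := (Fin m ↪o P) →₀ k

variable {P} in
/-- The face of a simplex obtained by omitting the `i`-th vertex. -/
def face {m : ℕ} (i : Fin (m + 1)) (s : Fin (m + 1) ↪o P) : Fin m ↪o P :=
  (Fin.succAboveOrderEmb i).trans s

/-- The simplicial boundary map (the augmentation if `m = 0`). -/
def boundary (m : ℕ) : ReducedChains k P (m + 1) →ₗ[k] ReducedChains k P m :=
  Finsupp.linearCombination k fun s =>
    ∑ i : Fin (m + 1), Finsupp.single (face i s) ((-1 : k) ^ (i : ℕ))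

theorem boundary_single (m : ℕ) (s : Fin (m + 1) ↪o P) (c : k) :
    boundary k P m (Finsupp.single s c) =
      ∑ i : Fin (m + 1), c • Finsupp.single (face i s) ((-1 : k) ^ (i : ℕ)) := by
  rw [boundary, Finsupp.linearCombination_single, Finset.smul_sum]

theorem boundary_comp_boundary (m : ℕ) : boundary k P m ∘ₗ boundary k P (m + 1) = 0 := by
  refine Finsupp.lhom_ext fun s c => ?_
  rw [LinearMap.comp_apply, boundary_single, map_sum, LinearMap.zero_apply]
  simp only [Finsupp.smul_single, boundary_single, smul_eq_mul]
  rw [← Finset.sum_product', Finset.univ_product_univ]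
  let S : Finset (Fin (m + 2) × Fin (m + 1)) := {ij | (ij.1 : ℕ) ≤ (ij.2 : ℕ)}
  rw [← Finset.sum_add_sum_compl S, ← eq_neg_iff_add_eq_zero, ← Finset.sum_neg_distrib]
  let φ : ∀ ij : Fin (m + 2) × Fin (m + 1), ij ∈ S → Fin (m + 2) × Fin (m + 1) := fun ij hij =>
    (ij.2.succ, Fin.castLT ij.1 (lt_of_le_of_lt (Finset.mem_filter.mp hij).right (Fin.is_lt ij.2)))
  apply Finset.sum_bij φ
  · intro ij hij
    simp_rw [S, φ, Finset.compl_filter, Finset.mem_filter_univ, Fin.val_succ,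
      Fin.val_castLT] at hij ⊢
    lia
  · rintro ⟨i, j⟩ hij ⟨i', j'⟩ hij' h
    simp only [φ, Prod.mk_inj, Fin.ext_iff, Fin.val_castLT, Fin.val_succ] at h
    ext
    · exact h.2
    · exact Nat.succ_injective h.1
  · rintro ⟨i', j'⟩ hij'
    simp_rw [S, Finset.compl_filter, Finset.mem_filter_univ, not_le] at hij'
    refine ⟨(Fin.castSucc j', i'.pred ?_), ?_, ?_⟩
    · rintro rfl
      simp at hij'
    · simpa [S] using Nat.le_sub_one_of_lt hij'
    · simp only [φ, Fin.castLT_castSucc, Fin.succ_pred]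
  · rintro ⟨i, j⟩ hij
    have hle : (i : ℕ) ≤ (j : ℕ) := (Finset.mem_filter.mp hij).right
    have hface : face j (face i s) =
        face (Fin.castLT i (lt_of_le_of_lt hle j.is_lt)) (face j.succ s) := by
      ext x
      change s (i.succAbove (j.succAbove x)) =
        s (j.succ.succAbove ((Fin.castLT i (lt_of_le_of_lt hle j.is_lt)).succAbove x))
      congr 1
      ext
      simp only [Fin.succAbove, Fin.lt_def, Fin.val_castSucc, Fin.val_succ, Fin.val_castLT]
      split_ifs <;> simp_all <;> lia
    simp only [φ, hface, ← Finsupp.single_neg]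
    congr 1
    simp only [Fin.val_succ, Fin.val_castLT, pow_succ]
    ring

/-- The augmented simplicial chain complex of the order complex of `P`, shifted so that simplices
with `m` vertices, which have dimension `m - 1`, are placed in degree `m`. -/
def reducedComplex : ChainComplex (ModuleCat.{max u v} k) ℕ :=
  ChainComplex.of (fun m => ModuleCat.of k (ReducedChains k P m))
    (fun m => ModuleCat.ofHom (boundary k P m))
    (fun m => by rw [← ModuleCat.ofHom_comp, boundary_comp_boundary]; rfl)

/-- The reduced homology, in degree `n ≥ 0` and with coefficients in `k`, of the order complex
of `P`. -/
def reducedHomology (n : ℕ) : ModuleCat.{max u v} k :=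
  (reducedComplex k P).homology (n + 1)

end OrderComplex

end HomotopyPath

end

noncomputable section

namespace HomotopyPath

open PathAlgebra CategoryTheory

namespace HPA

variable {k : Type u} [CommRing k] {Q : Type v} [Quiver.{w} Q] [Fintype Q] {H : HPA k Q}

/-! ### Composition in the path category of a homotopy path algebra -/

/-! Left cancellation makes concatenation `y ↦ x y` strictly increasing on the classes `y` that
start where `x` ends. So `A` acts by left multiplication on strict chains `c_0 < ⋯ < c_n` of
`Path_A`. Let `B_n` be the free `k`-module on the chains whose top element ends in `b`. Writing `c_i
= c_{i-1} r_i`, such a chain is the bar symbol `c_0[r_1|⋯|r_n]` with nontrivial `r_i`, and the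
differential deletes each `c_j` except the top one. The missing top face would let the nontrivial
path `r_n` act on `S_b`, where it acts as zero.

Each chain is uniquely `c_0` times a chain starting at a trivial path, so `B_n` is projective.
Prepending the trivial path is a `k`-linear contracting homotopy, so `B` resolves `S_b`.

In `S_a ⊗_A B` a chain with `c_0 ≠ e_a` vanishes, because `c_0` can be moved across the tensor sign,
where it acts as zero. What remains are the chains `e_a < y_1 < ⋯ < y_m < p`. Deleting `e_a` gives
zero, and every other face keeps both ends. Up to sign this is the direct sum over `p` of the
augmented chain complexes of `(e_a, p)`, with simplices on `m` vertices in degree `m + 1`. Hence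
degree `i` of `Tor` sees dimension `i - 2`.

The identification fails to be onto only at `m = 0`, where `p = e_a` contributes an empty simplex
without a chain. For `i ≥ 2` that degree occurs only as the target of the differential, and
injectivity suffices there.

The load is carried by `Paths.mul_left_cancel`, `Bar.diff_homotopy_succ`, `toInterval_diff`, the two
inverse identities for `tensorToInterval`, and `nonempty_homology_equiv_directSum`. -/

theorem Paths.exists_rep (x : H.Paths) :
    ∃ (a b : Q) (p : Quiver.Path a b), x = H.pathMk p := by
  obtain ⟨a, b, x⟩ := x
  induction x using Quotient.inductionOn with
  | h p => exact ⟨a, b, p, rfl⟩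

theorem Paths.exists_rep_pair {x y : H.Paths} (h : x.head = y.tail) :
    ∃ (a b c : Q) (p : Quiver.Path a b) (q : Quiver.Path b c),
      x = H.pathMk p ∧ y = H.pathMk q := by
  obtain ⟨a, b, p, rfl⟩ := x.exists_rep
  obtain ⟨b', c, q, rfl⟩ := y.exists_rep
  obtain rfl : b = b' := h
  exact ⟨a, b, c, p, q, rfl, rfl⟩

theorem pathMk_eq_iff {a b : Q} {p q : Quiver.Path a b} :
    H.pathMk p = H.pathMk q ↔ of k p - of k q ∈ H.ideal := by
  constructor
  · intro h
    obtain ⟨-, -, h⟩ := (Paths.mk.injEq ..).mp h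
    exact Quotient.exact (s := H.pathSetoid a b) (eq_of_heq h)
  · intro h
    have : Quotient.mk (H.pathSetoid a b) p = Quotient.mk (H.pathSetoid a b) q :=
      Quotient.sound h
    rw [pathMk, pathMk, this]

/-- Composition of classes of paths. -/
def PathClass.comp {a b c : Q} : H.PathClass a b → H.PathClass b c → H.PathClass a c :=
  Quotient.map₂ (sa := H.pathSetoid a b) (sb := H.pathSetoid b c) (sc := H.pathSetoid a c)
    Quiver.Path.comp (by
      intro p p' hp q q' hq
      change of k (p.comp q) - of k (p'.comp q') ∈ H.ideal
      rw [← of_mul_of, ← of_mul_of, ← sub_add_sub_cancel _ (of k p' * of k q) _, ← sub_mul,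
        ← mul_sub]
      exact add_mem (TwoSidedIdeal.mul_mem_right _ _ _ hp)
        (TwoSidedIdeal.mul_mem_left _ _ _ hq))

open Classical in
/-- The product of two elements of `Path_A`, equal to the left factor if they are not
composable. -/
instance : Mul H.Paths where
  mul x y := if h : y.tail = x.head then ⟨x.tail, y.head, x.cls.comp (h ▸ y.cls)⟩ else x

theorem pathMk_mul {a b c : Q} (p : Quiver.Path a b) (q : Quiver.Path b c) :
    H.pathMk p * H.pathMk q = H.pathMk (p.comp q) :=
  dif_pos (rfl : b = b)

theorem Paths.tail_mul (x y : H.Paths) : (x * y).tail = x.tail := by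
  by_cases h : y.tail = x.head
  · obtain ⟨a, b, c, p, q, rfl, rfl⟩ := Paths.exists_rep_pair h.symm
    rw [pathMk_mul]
    rfl
  · exact congrArg Paths.tail (dif_neg h)

theorem Paths.head_mul {x y : H.Paths} (h : x.head = y.tail) : (x * y).head = y.head := by
  obtain ⟨a, b, c, p, q, rfl, rfl⟩ := Paths.exists_rep_pair h
  rw [pathMk_mul]
  rfl

theorem Paths.mul_assoc {x y z : H.Paths} (h : x.head = y.tail) (h' : y.head = z.tail) :
    x * y * z = x * (y * z) := by
  obtain ⟨a, b, c, p, q, rfl, rfl⟩ := Paths.exists_rep_pair h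
  obtain ⟨c', d, r, rfl⟩ := z.exists_rep
  obtain rfl : c = c' := h'
  simp only [pathMk_mul, Quiver.Path.comp_assoc]

theorem Paths.idPath_mul {x : H.Paths} {a : Q} (h : a = x.tail) : H.idPath a * x = x := by
  obtain ⟨b, c, p, rfl⟩ := x.exists_rep
  obtain rfl : a = b := h
  rw [idPath, pathMk_mul, Quiver.Path.nil_comp]

theorem Paths.mul_idPath {x : H.Paths} {a : Q} (h : x.head = a) : x * H.idPath a = x := by
  obtain ⟨b, c, p, rfl⟩ := x.exists_rep
  obtain rfl : c = a := h
  rw [idPath, pathMk_mul, Quiver.Path.comp_nil]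

/-- The axiom `left_cancel` enters here, in the form in which everything later uses it. -/
theorem Paths.mul_left_cancel {x y z : H.Paths} (h : x.head = y.tail) (h' : x.head = z.tail)
    (e : x * y = x * z) : y = z := by
  obtain ⟨a, b, c, p, q, rfl, rfl⟩ := Paths.exists_rep_pair h
  obtain ⟨b', d, r, rfl⟩ := z.exists_rep
  obtain rfl : b = b' := h'
  rw [pathMk_mul, pathMk_mul] at e
  obtain rfl : c = d := congrArg Paths.head e
  rw [pathMk_eq_iff] at e
  rw [pathMk_eq_iff]
  -- The axiom speaks only of nonzero differences. If the difference vanishes in `kQ`, then either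
  -- `k` is trivial or the two concatenations are the same path of `Q`, and left factors cancel in
  -- the free path category.
  by_cases h0 : of k (p.comp q) - of k (p.comp r) = 0
  · rcases subsingleton_or_nontrivial k with hk | hk
    · have : Subsingleton (PathAlgebra k Q) := Module.subsingleton k _
      rw [Subsingleton.elim (of k q - of k r) 0]
      exact zero_mem _
    · have h1 : (⟨a, c, p.comp q⟩ : AllPaths Q) = ⟨a, c, p.comp r⟩ :=
        Finsupp.single_left_injective (one_ne_zero (α := k)) (sub_eq_zero.1 h0)
      obtain ⟨-, h1⟩ := Sigma.mk.inj_iff.1 h1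
      obtain ⟨-, h1⟩ := Sigma.mk.inj_iff.1 (eq_of_heq h1)
      rw [Quiver.Path.comp_injective_right _ (eq_of_heq h1), sub_self]
      exact zero_mem _
  · rw [← of_mul_of, ← of_mul_of] at h0 e
    exact H.left_cancel _ _ _ h0 e

/-! ### The prefix order and left division -/

section Order

variable [AcyclicQuiver Q]

theorem Paths.le_iff {x y : H.Paths} : x ≤ y ↔ ∃ r : H.Paths, x.head = r.tail ∧ x * r = y := by
  constructor
  · rintro ⟨a, b, c, p, r, rfl, rfl⟩
    exact ⟨H.pathMk r, rfl, pathMk_mul p r⟩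
  · rintro ⟨r, h, rfl⟩
    obtain ⟨a, b, c, p, q, rfl, rfl⟩ := Paths.exists_rep_pair h
    exact ⟨a, b, c, p, q, rfl, pathMk_mul p q⟩

theorem Paths.tail_eq_of_le {x y : H.Paths} (h : x ≤ y) : x.tail = y.tail := by
  obtain ⟨r, -, rfl⟩ := Paths.le_iff.1 h
  rw [Paths.tail_mul]

theorem Paths.idPath_le {x : H.Paths} {a : Q} (h : a = x.tail) : H.idPath a ≤ x :=
  Paths.le_iff.2 ⟨x, h, Paths.idPath_mul h⟩

theorem Paths.eq_idPath_of_le {x : H.Paths} {a : Q} (h : x ≤ H.idPath a) : x = H.idPath a :=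
  le_antisymm h (Paths.idPath_le (Paths.tail_eq_of_le h).symm)

theorem Paths.idPath_lt {x : H.Paths} (h : x ≠ H.idPath x.tail) : H.idPath x.tail < x :=
  lt_of_le_of_ne (Paths.idPath_le rfl) h.symm

/-- Monotonicity is associativity and strictness is cancellation. This is what lets paths act on
strict chains. -/
theorem Paths.mul_lt_mul_left {x y z : H.Paths} (h : x.head = y.tail) (hyz : y < z) :
    x * y < x * z := by
  have h' : x.head = z.tail := h.trans (Paths.tail_eq_of_le hyz.le)
  refine lt_of_le_of_ne ?_ fun e => hyz.ne (Paths.mul_left_cancel h h' e)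
  obtain ⟨r, hr, rfl⟩ := Paths.le_iff.1 hyz.le
  exact Paths.le_iff.2 ⟨r, (Paths.head_mul h).trans hr, Paths.mul_assoc h hr⟩

/-- If `y = x r` then `ldiv x y = r`. -/
def Paths.ldiv (x y : H.Paths) : H.Paths :=
  haveI : Nonempty H.Paths := ⟨x⟩
  Classical.epsilon fun r => x.head = r.tail ∧ x * r = y

theorem Paths.tail_ldiv {x y : H.Paths} (h : x ≤ y) : (x.ldiv y).tail = x.head :=
  (Classical.epsilon_spec_aux _ _ (Paths.le_iff.1 h)).1.symm

theorem Paths.mul_ldiv {x y : H.Paths} (h : x ≤ y) : x * x.ldiv y = y :=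
  (Classical.epsilon_spec_aux _ _ (Paths.le_iff.1 h)).2

theorem Paths.head_ldiv {x y : H.Paths} (h : x ≤ y) : (x.ldiv y).head = y.head := by
  rw [← Paths.head_mul (Paths.tail_ldiv h).symm, Paths.mul_ldiv h]

/-- The quotient is unique by cancellation, so the choice made in `ldiv` is harmless when `x ≤ y`.
-/
theorem Paths.ldiv_eq {x y r : H.Paths} (h : x.head = r.tail) (e : x * r = y) :
    x.ldiv y = r := by
  have hle : x ≤ y := Paths.le_iff.2 ⟨r, h, e⟩
  exact Paths.mul_left_cancel (Paths.tail_ldiv hle).symm h ((Paths.mul_ldiv hle).trans e.symm)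

theorem Paths.ldiv_self (x : H.Paths) : x.ldiv x = H.idPath x.head :=
  Paths.ldiv_eq rfl (Paths.mul_idPath rfl)

theorem Paths.ldiv_mul_mul {r x y : H.Paths} (h : r.head = x.tail) (hxy : x ≤ y) :
    (r * x).ldiv (r * y) = x.ldiv y := by
  have h1 := Paths.tail_ldiv hxy
  refine Paths.ldiv_eq ((Paths.head_mul h).trans h1.symm) ?_
  rw [Paths.mul_assoc h h1.symm, Paths.mul_ldiv hxy]

/-- If `z = y r`, then the quotient of `z` by `x` is that of `y` followed by `r`; equal quotients
would give `y = z`. -/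
theorem Paths.ldiv_lt_ldiv {x y z : H.Paths} (hxy : x ≤ y) (hyz : y < z) :
    x.ldiv y < x.ldiv z := by
  have hxz := hxy.trans hyz.le
  refine lt_of_le_of_ne ?_ fun e => hyz.ne ?_
  · obtain ⟨r, hr, rfl⟩ := Paths.le_iff.1 hyz.le
    have hr' : (x.ldiv y).head = r.tail := (Paths.head_ldiv hxy).trans hr
    refine Paths.le_iff.2 ⟨r, hr', (Paths.ldiv_eq ?_ ?_).symm⟩
    · rw [Paths.tail_mul, Paths.tail_ldiv hxy]
    · rw [← Paths.mul_assoc (Paths.tail_ldiv hxy).symm hr', Paths.mul_ldiv hxy]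
  · rw [← Paths.mul_ldiv hxy, e, Paths.mul_ldiv hxz]

end Order

/-! ### The images of paths in the algebra -/

/-- The element of `A` given by an element of `Path_A`. -/
def basisElt (x : H.Paths) : H.Alg :=
  Quotient.lift (s := H.pathSetoid x.tail x.head) (fun p => H.toAlg (of k p))
    (fun _ _ h => (RingCon.eq _).2 ((TwoSidedIdeal.rel_iff _ _ _).2 h)) x.cls

theorem basisElt_pathMk {a b : Q} (p : Quiver.Path a b) :
    basisElt (H.pathMk p) = H.toAlg (of k p) := rfl

theorem basisElt_mul {x y : H.Paths} (h : x.head = y.tail) :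
    basisElt x * basisElt y = basisElt (x * y) := by
  obtain ⟨a, b, c, p, q, rfl, rfl⟩ := Paths.exists_rep_pair h
  rw [pathMk_mul, basisElt_pathMk, basisElt_pathMk, basisElt_pathMk, ← map_mul, of_mul_of]

theorem basisElt_mul_of_ne {x y : H.Paths} (h : x.head ≠ y.tail) :
    basisElt x * basisElt y = 0 := by
  obtain ⟨a, b, p, rfl⟩ := x.exists_rep
  obtain ⟨c, d, q, rfl⟩ := y.exists_rep
  rw [basisElt_pathMk, basisElt_pathMk, ← map_mul, single_mul_single_of_ne _ _ (Ne.symm h),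
    map_zero]

theorem toAlg_smul (c : k) (f : PathAlgebra k Q) : H.toAlg (c • f) = c • H.toAlg f := rfl

/-- The path classes span `A`. Their linear independence in `A` is never needed. -/
theorem alg_induction {motive : H.Alg → Prop} (x : H.Alg) (zero : motive 0)
    (add : ∀ x y, motive x → motive y → motive (x + y))
    (smul : ∀ (c : k) (x : H.Paths), motive (c • basisElt x)) : motive x := by
  obtain ⟨f, rfl⟩ : ∃ f, H.toAlg f = x := Quotient.exists_rep x
  induction f using PathAlgebra.induction with
  | zero => rwa [map_zero]
  | add f g hf hg => rw [map_add]; exact add _ _ hf hg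
  | smul c p => exact smul c (H.pathMk p.2.2)

theorem evalVertex_basisElt_idPath [AcyclicQuiver Q] (a : Q) :
    H.evalVertex a (basisElt (H.idPath a)) = 1 := by
  rw [idPath, basisElt_pathMk, evalVertex_toAlg, coeff_single, if_pos rfl]

theorem evalVertex_basisElt_of_ne [AcyclicQuiver Q] {a : Q} {x : H.Paths} (h : x ≠ H.idPath a) :
    H.evalVertex a (basisElt x) = 0 := by
  obtain ⟨b, c, p, rfl⟩ := x.exists_rep
  rw [basisElt_pathMk, evalVertex_toAlg, coeff_single, if_neg]
  intro e
  obtain ⟨rfl, e⟩ := Sigma.mk.inj_iff.1 e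
  obtain ⟨rfl, e⟩ := Sigma.mk.inj_iff.1 (eq_of_heq e)
  exact h (by rw [eq_of_heq e]; rfl)

theorem evalVertex_smul [AcyclicQuiver Q] (a : Q) (c : k) (x : H.Alg) :
    H.evalVertex a (c • x) = c * H.evalVertex a x := by
  obtain ⟨f, rfl⟩ : ∃ f, H.toAlg f = x := Quotient.exists_rep x
  rw [← toAlg_smul, evalVertex_toAlg, evalVertex_toAlg, map_smul, smul_eq_mul]

/-- A representation of `A` from a compatible action of `Path_A`. -/
def liftEnd {M : Type*} [AddCommGroup M] [Module k M] (ρ : H.Paths → Module.End k M)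
    (hmul : ∀ x y, x.head = y.tail → ρ x * ρ y = ρ (x * y))
    (hzero : ∀ x y, x.head ≠ y.tail → ρ x * ρ y = 0)
    (hone : ∑ a, ρ (H.idPath a) = 1) : H.Alg →+* Module.End k M :=
  let F : PathAlgebra k Q →ₗ[k] Module.End k M :=
    Finsupp.linearCombination k fun p : AllPaths Q => ρ (H.pathMk p.2.2)
  have hF : ∀ p, F (single k p) = ρ (H.pathMk p.2.2) := fun p =>
    (Finsupp.linearCombination_single k (1 : k) p).trans (one_smul _ _)
  let G : PathAlgebra k Q →+* Module.End k M :=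
    { toFun := F
      map_zero' := map_zero F
      map_add' := map_add F
      map_one' := by
        rw [one_def, map_sum, ← hone]
        exact Finset.sum_congr rfl fun a _ => hF _
      map_mul' := fun f g => by
        induction f using PathAlgebra.induction with
        | zero => rw [zero_mul, map_zero, zero_mul]
        | add f f' hf hf' => rw [add_mul, map_add, hf, hf', map_add, add_mul]
        | smul c p =>
          induction g using PathAlgebra.induction with
          | zero => rw [mul_zero, map_zero, mul_zero]
          | add f f' hf hf' => rw [mul_add, map_add, hf, hf', map_add, mul_add]
          | smul c' q =>
            rw [smul_mul_smul_comm, map_smul, map_smul, map_smul, smul_mul_smul_comm, hF, hF]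
            congr 1
            obtain ⟨a, b, p⟩ := p
            obtain ⟨b', d, q⟩ := q
            by_cases h : b = b'
            · subst h
              rw [of_mul_of, hF, hmul _ _ rfl, pathMk_mul]
            · rw [single_mul_single_of_ne _ _ (Ne.symm h), map_zero, hzero _ _ h] }
  RingCon.lift H.ideal.ringCon G (by
    -- A generator `p - p'` of the ideal is killed because `p` and `p'` define the same element of
    -- `Path_A`, and `ρ` depends only on that element.
    have hI : H.ideal ≤ TwoSidedIdeal.ker G := by
      refine TwoSidedIdeal.span_le.2 ?_
      rintro _ ⟨b, c, T, hT, p, hp, p', hp', rfl⟩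
      refine (TwoSidedIdeal.mem_ker _).2 ?_
      have : H.pathMk p = H.pathMk p' :=
        pathMk_eq_iff.2 (TwoSidedIdeal.subset_span ⟨b, c, T, hT, p, hp, p', hp', rfl⟩)
      rw [map_sub, sub_eq_zero]
      exact (hF ⟨b, c, p⟩).trans ((congrArg ρ this).trans (hF ⟨b, c, p'⟩).symm)
    intro x y hxy
    have h := hI (((TwoSidedIdeal.rel_iff _ _ _).1 hxy : x - y ∈ H.ideal))
    rw [TwoSidedIdeal.mem_ker, map_sub, sub_eq_zero] at h
    exact h)

section liftEnd

variable {M : Type*} [AddCommGroup M] [Module k M] (ρ : H.Paths → Module.End k M)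
  (hmul : ∀ x y, x.head = y.tail → ρ x * ρ y = ρ (x * y))
  (hzero : ∀ x y, x.head ≠ y.tail → ρ x * ρ y = 0)
  (hone : ∑ a, ρ (H.idPath a) = 1)

theorem liftEnd_basisElt (x : H.Paths) : liftEnd ρ hmul hzero hone (basisElt x) = ρ x := by
  obtain ⟨a, b, p, rfl⟩ := x.exists_rep
  exact (Finsupp.linearCombination_single k (1 : k) _).trans (one_smul _ _)

theorem liftEnd_smul (c : k) (x : H.Alg) :
    liftEnd ρ hmul hzero hone (c • x) = c • liftEnd ρ hmul hzero hone x := by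
  obtain ⟨f, rfl⟩ : ∃ f, H.toAlg f = x := Quotient.exists_rep x
  exact map_smul (Finsupp.linearCombination k fun p : AllPaths Q => ρ (H.pathMk p.2.2)) c f

end liftEnd

end HPA

namespace HPA

variable {k : Type u} [CommRing k] {Q : Type v} [Quiver.{w} Q] [Fintype Q]

section AlgLinear

variable {H : HPA k Q} {M N : Type*} [AddCommGroup M] [Module k M] [Module H.Alg M]
  [IsScalarTower k H.Alg M] [AddCommGroup N] [Module k N] [Module H.Alg N]
  [IsScalarTower k H.Alg N]

/-- A `k`-linear map that commutes with the action of paths is `A`-linear. -/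
def algLinearMap (f : M →ₗ[k] N) (h : ∀ (x : H.Paths) (m : M),
    f (basisElt x • m) = basisElt x • f m) : M →ₗ[H.Alg] N where
  __ := f
  map_smul' := fun x m => by
    change f (x • m) = x • f m
    induction x using alg_induction with
    | zero => rw [zero_smul, zero_smul, map_zero]
    | add x y hx hy => rw [add_smul, map_add, hx, hy, add_smul]
    | smul c x => rw [smul_assoc, map_smul, h, smul_assoc]

end AlgLinear

variable [AcyclicQuiver Q] (H : HPA k Q) (b : Q)

/-! ### The normalized bar resolution of a simple module -/

/-- The chains `c_0 < ⋯ < c_n` of `Path_A` for which `c_n` ends in `b`. -/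
@[ext]
structure Chain (n : ℕ) : Type (max v w) where
  toFun : Fin (n + 1) → H.Paths
  strictMono : StrictMono toFun
  head_last : (toFun (Fin.last n)).head = b

/-! ### Chains in the path poset -/

namespace Chain

variable {H b} {n : ℕ}

instance : CoeFun (H.Chain b n) fun _ => Fin (n + 1) → H.Paths := ⟨toFun⟩

theorem ext_apply {c c' : H.Chain b n} (h : ∀ i, c i = c' i) : c = c' :=
  Chain.ext (funext h)

theorem zero_le (c : H.Chain b n) (i : Fin (n + 1)) : c 0 ≤ c i :=
  c.strictMono.monotone (Fin.zero_le i)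

theorem tail_eq (c : H.Chain b n) (i : Fin (n + 1)) : (c i).tail = (c 0).tail :=
  (Paths.tail_eq_of_le (c.zero_le i)).symm

/-- The chain `x c_0 < ⋯ < x c_n`. -/
def act (x : H.Paths) (c : H.Chain b n) (h : x.head = (c 0).tail) : H.Chain b n where
  toFun i := x * c i
  strictMono _ _ hij := Paths.mul_lt_mul_left (h.trans (c.tail_eq _).symm) (c.strictMono hij)
  head_last := (Paths.head_mul (h.trans (c.tail_eq _).symm)).trans c.head_last

theorem act_apply (x : H.Paths) (c : H.Chain b n) (h : x.head = (c 0).tail) (i : Fin (n + 1)) :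
    c.act x h i = x * c i := rfl

theorem act_act {x y : H.Paths} {c : H.Chain b n} (h : y.head = (c 0).tail)
    (hxy : x.head = y.tail) :
    (c.act y h).act x (hxy.trans (Paths.tail_mul _ _).symm) =
      c.act (x * y) ((Paths.head_mul hxy).trans h) :=
  ext_apply fun i => (Paths.mul_assoc hxy (h.trans (c.tail_eq i).symm)).symm

/-- The chain `e < c_0⁻¹ c_1 < ⋯ < c_0⁻¹ c_n`. -/
def strip (c : H.Chain b n) : H.Chain b n where
  toFun i := (c 0).ldiv (c i)
  strictMono _ _ hij := Paths.ldiv_lt_ldiv (c.zero_le _) (c.strictMono hij)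
  head_last := (Paths.head_ldiv (c.zero_le _)).trans c.head_last

theorem strip_zero (c : H.Chain b n) : c.strip 0 = H.idPath (c 0).head := Paths.ldiv_self _

theorem tail_strip (c : H.Chain b n) : (c 0).head = (c.strip 0).tail := by
  rw [strip_zero]; rfl

/-- Together with `strip_act`: a chain is recovered from `c_0` and a based chain, and multiplication
by a path changes only `c_0`. The projectivity of the bar modules rests on this. -/
theorem act_strip (c : H.Chain b n) : c.strip.act (c 0) c.tail_strip = c :=
  ext_apply fun i => Paths.mul_ldiv (c.zero_le i)

theorem strip_act {x : H.Paths} {c : H.Chain b n} (h : x.head = (c 0).tail) :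
    (c.act x h).strip = c.strip :=
  ext_apply fun i => Paths.ldiv_mul_mul h (c.zero_le i)

/-- The chain `c` with `c_j` omitted, where `c_j` is not the top element. -/
def face (c : H.Chain b (n + 1)) (j : Fin (n + 1)) : H.Chain b n where
  toFun i := c (j.castSucc.succAbove i)
  strictMono := c.strictMono.comp (Fin.strictMono_succAbove _)
  head_last := by
    rw [Fin.succAbove_ne_last_last (Fin.castSucc_lt_last j).ne]
    exact c.head_last

theorem face_apply (c : H.Chain b (n + 1)) (j : Fin (n + 1)) (i : Fin (n + 1)) :
    c.face j i = c (j.castSucc.succAbove i) := rfl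

theorem face_succ_zero (c : H.Chain b (n + 2)) (j : Fin (n + 1)) : c.face j.succ 0 = c 0 := by
  rw [face_apply, Fin.succAbove_ne_zero_zero]
  exact Fin.castSucc_ne_zero_iff.2 (Fin.succ_ne_zero j)

theorem tail_face (c : H.Chain b (n + 1)) (j : Fin (n + 1)) :
    (c.face j 0).tail = (c 0).tail := c.tail_eq _

theorem face_act {x : H.Paths} {c : H.Chain b (n + 1)} (h : x.head = (c 0).tail)
    (j : Fin (n + 1)) : (c.act x h).face j = (c.face j).act x (h.trans (c.tail_face j).symm) :=
  rfl

/-- A chain is based if its first element is a trivial path. -/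
def IsBased (c : H.Chain b n) : Prop := c 0 = H.idPath (c 0).tail

theorem strip_isBased (c : H.Chain b n) : c.strip.IsBased := by
  rw [IsBased, strip_zero]; rfl

/-- Trivial paths are minimal in `Path_A`. -/
theorem not_isBased_of_lt {c : H.Chain b n} {x : H.Paths} (h : x < c 0) : ¬ c.IsBased :=
  fun h' => h.ne (by rw [h'] at h ⊢; exact Paths.eq_idPath_of_le h.le)

theorem ne_idPath {c : H.Chain b n} (h : ¬ c.IsBased) (i : Fin (n + 1)) :
    c i ≠ H.idPath (c 0).tail := fun h' => h (Paths.eq_idPath_of_le (h' ▸ c.zero_le i))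

theorem face_not_isBased {c : H.Chain b (n + 1)} (h : ¬ c.IsBased) (j : Fin (n + 1)) :
    ¬ (c.face j).IsBased := by
  intro h'
  rw [IsBased, tail_face] at h'
  exact ne_idPath h _ h'

theorem face_zero_not_isBased (c : H.Chain b (n + 1)) : ¬ (c.face 0).IsBased :=
  not_isBased_of_lt (c.strictMono (Fin.succ_pos 0))

theorem face_succ_isBased {c : H.Chain b (n + 2)} (h : c.IsBased) (j : Fin (n + 1)) :
    (c.face j.succ).IsBased := by
  rw [IsBased, face_succ_zero]; exact h

theorem eq_idPath_of_isBased {c : H.Chain b 0} (h : c.IsBased) : c 0 = H.idPath b := by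
  have h1 := c.head_last
  rw [show Fin.last 0 = 0 from rfl, h] at h1
  rw [h]
  exact congrArg H.idPath h1

/-- The chain `e < c_0 < ⋯ < c_n`. -/
def cons (c : H.Chain b n) (h : ¬ c.IsBased) : H.Chain b (n + 1) where
  toFun := Fin.cons (H.idPath (c 0).tail) c.toFun
  strictMono := by
    refine Fin.strictMono_iff_lt_succ.2 fun i => ?_
    cases i using Fin.cases with
    | zero => exact Paths.idPath_lt h
    | succ i => exact c.strictMono (Fin.castSucc_lt_succ (i := i))
  head_last := c.head_last

theorem cons_zero (c : H.Chain b n) (h : ¬ c.IsBased) : c.cons h 0 = H.idPath (c 0).tail := rfl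

theorem cons_succ (c : H.Chain b n) (h : ¬ c.IsBased) (i : Fin (n + 1)) :
    c.cons h i.succ = c i := rfl

theorem face_zero_cons (c : H.Chain b n) (h : ¬ c.IsBased) : (c.cons h).face 0 = c := rfl

theorem cons_face_zero {c : H.Chain b (n + 1)} (h : c.IsBased) :
    (c.face 0).cons c.face_zero_not_isBased = c := by
  refine ext_apply fun i => ?_
  cases i using Fin.cases with
  | zero => rw [cons_zero, tail_face]; exact h.symm
  | succ i => rfl

theorem face_succ_cons {c : H.Chain b (n + 1)} (h : ¬ c.IsBased) (j : Fin (n + 1)) :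
    (c.cons h).face j.succ = (c.face j).cons (face_not_isBased h j) := by
  refine ext_apply fun i => ?_
  cases i using Fin.cases with
  | zero => rw [face_succ_zero, cons_zero, cons_zero, tail_face]
  | succ i =>
    rw [face_apply, cons_succ, face_apply, ← Fin.succ_castSucc, Fin.succ_succAbove_succ,
      cons_succ]

end Chain

/-- The `n`-th term of the bar resolution of `S_b`: the free `k`-module on the chains with `n + 1`
elements whose top element ends in `b`. -/
def Bar (n : ℕ) : Type (max u v w) := H.Chain b n →₀ k

/-! ### The bar modules and the action of the algebra -/

namespace Bar

variable {H b} {n : ℕ}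

instance : AddCommGroup (H.Bar b n) := inferInstanceAs (AddCommGroup (H.Chain b n →₀ k))

instance : Module k (H.Bar b n) := inferInstanceAs (Module k (H.Chain b n →₀ k))

/-- The basis element of a chain. -/
def gen (c : H.Chain b n) : H.Bar b n := Finsupp.single c (1 : k)

/-- The `k`-linear map with prescribed values on chains. -/
def lift {M : Type*} [AddCommGroup M] [Module k M] (f : H.Chain b n → M) : H.Bar b n →ₗ[k] M :=
  Finsupp.linearCombination k f

theorem lift_gen {M : Type*} [AddCommGroup M] [Module k M] (f : H.Chain b n → M)
    (c : H.Chain b n) : lift f (gen c) = f c :=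
  (Finsupp.linearCombination_single k (1 : k) c).trans (one_smul _ _)

theorem hom_ext {M : Type*} [AddCommGroup M] [Module k M] {f g : H.Bar b n →ₗ[k] M}
    (h : ∀ c, f (gen c) = g (gen c)) : f = g :=
  Finsupp.lhom_ext' fun c => LinearMap.ext_ring (h c)

theorem induction {motive : H.Bar b n → Prop} (m : H.Bar b n) (zero : motive 0)
    (add : ∀ x y, motive x → motive y → motive (x + y))
    (smul : ∀ (r : k) (c : H.Chain b n), motive (r • gen c)) : motive m := by
  refine Finsupp.induction_linear (motive := motive) m zero add fun c r => ?_
  have h : r • gen c = (Finsupp.single c r : H.Chain b n →₀ k) :=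
    (Finsupp.smul_single r c (1 : k)).trans (by rw [smul_eq_mul, mul_one])
  exact h ▸ smul r c

open Classical in
/-- The action of `Path_A` on chains, extended by zero. -/
def rep (x : H.Paths) : Module.End k (H.Bar b n) :=
  lift fun c => if h : x.head = (c 0).tail then gen (c.act x h) else 0

theorem rep_gen {x : H.Paths} {c : H.Chain b n} (h : x.head = (c 0).tail) :
    rep x (gen c) = gen (c.act x h) := by
  rw [rep, lift_gen, dif_pos h]

theorem rep_gen_of_ne {x : H.Paths} {c : H.Chain b n} (h : x.head ≠ (c 0).tail) :
    rep x (gen c) = 0 := by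
  rw [rep, lift_gen, dif_neg h]

variable (H b n) in
/-- The action of `A` on the bar resolution. -/
def repHom : H.Alg →+* Module.End k (H.Bar b n) :=
  liftEnd rep
    (fun x y hxy => hom_ext fun c => by
      rw [Module.End.mul_apply]
      by_cases h : y.head = (c 0).tail
      · rw [rep_gen h, rep_gen (hxy.trans (Paths.tail_mul _ _).symm),
          rep_gen ((Paths.head_mul hxy).trans h), Chain.act_act h hxy]
      · rw [rep_gen_of_ne h, map_zero, rep_gen_of_ne]
        rwa [Paths.head_mul hxy])
    (fun x y hxy => hom_ext fun c => by
      rw [Module.End.mul_apply]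
      by_cases h : y.head = (c 0).tail
      · rw [rep_gen h, rep_gen_of_ne, LinearMap.zero_apply]
        rwa [Chain.act_apply, Paths.tail_mul]
      · rw [rep_gen_of_ne h, map_zero, LinearMap.zero_apply])
    (hom_ext fun c => by
      -- All elements of a chain share one tail, so exactly one trivial path acts nontrivially on
      -- it, and that one fixes it.
      rw [LinearMap.sum_apply, Finset.sum_eq_single (c 0).tail, rep_gen rfl, Module.End.one_apply]
      · exact congrArg gen (Chain.ext_apply fun i => Paths.idPath_mul (c.tail_eq i).symm)
      · exact fun a _ ha => rep_gen_of_ne ha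
      · exact fun h => absurd (Finset.mem_univ _) h)

instance : Module H.Alg (H.Bar b n) := Module.compHom (H.Bar b n) (repHom H b n)

theorem smul_def (x : H.Alg) (m : H.Bar b n) : x • m = repHom H b n x m := rfl

theorem basisElt_smul (x : H.Paths) (m : H.Bar b n) : basisElt x • m = rep x m := by
  rw [smul_def, repHom, liftEnd_basisElt]

theorem basisElt_smul_gen {x : H.Paths} {c : H.Chain b n} (h : x.head = (c 0).tail) :
    basisElt x • gen c = gen (c.act x h) := by
  rw [basisElt_smul, rep_gen h]

theorem basisElt_smul_gen_of_ne {x : H.Paths} {c : H.Chain b n} (h : x.head ≠ (c 0).tail) :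
    basisElt x • gen c = 0 := by
  rw [basisElt_smul, rep_gen_of_ne h]

theorem basisElt_smul_gen_strip (c : H.Chain b n) :
    basisElt (c 0) • gen c.strip = gen c := by
  rw [basisElt_smul_gen c.tail_strip, Chain.act_strip]

instance : IsScalarTower k H.Alg (H.Bar b n) where
  smul_assoc c x m := by
    rw [smul_def, smul_def, repHom, liftEnd_smul]
    rfl

/-- The `A`-linear map determined by the images of chains. -/
def liftAlg {M : Type*} [AddCommGroup M] [Module k M] [Module H.Alg M] [IsScalarTower k H.Alg M]
    (f : H.Chain b n → M)
    (hf : ∀ (x : H.Paths) (c : H.Chain b n) (h : x.head = (c 0).tail),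
      f (c.act x h) = basisElt x • f c)
    (hf' : ∀ (x : H.Paths) (c : H.Chain b n), x.head ≠ (c 0).tail → basisElt x • f c = 0) :
    H.Bar b n →ₗ[H.Alg] M :=
  algLinearMap (lift f) fun x m => by
    have key : lift f ∘ₗ rep x = Algebra.lsmul k k M (basisElt x) ∘ₗ lift f := hom_ext fun c => by
      rw [LinearMap.comp_apply, LinearMap.comp_apply, lift_gen, Algebra.lsmul_coe]
      by_cases h : x.head = (c 0).tail
      · rw [rep_gen h, lift_gen, hf]
      · rw [rep_gen_of_ne h, map_zero]
        exact (hf' x c h).symm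
    rw [basisElt_smul]
    exact LinearMap.congr_fun key m

theorem liftAlg_gen {M : Type*} [AddCommGroup M] [Module k M] [Module H.Alg M]
    [IsScalarTower k H.Alg M] (f : H.Chain b n → M)
    (hf : ∀ (x : H.Paths) (c : H.Chain b n) (h : x.head = (c 0).tail),
      f (c.act x h) = basisElt x • f c)
    (hf' : ∀ (x : H.Paths) (c : H.Chain b n), x.head ≠ (c 0).tail → basisElt x • f c = 0)
    (c : H.Chain b n) : liftAlg f hf hf' (gen c) = f c := lift_gen f c

end Bar

end HPA

/-! ### Augmentation, differential and contracting homotopy -/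

namespace HPA

variable {k : Type u} [CommRing k] {Q : Type v} [Quiver.{w} Q] [Fintype Q] (H : HPA k Q) (b : Q)

/-- The generator of `S_b`. -/
def simpleOne : H.Simple b := ULift.up 1

theorem smul_simpleOne (s : H.Simple b) : s.down • H.simpleOne b = s :=
  ULift.ext _ _ (mul_one s.down)

variable [AcyclicQuiver Q]

instance : IsScalarTower k H.Alg (H.Simple b) where
  smul_assoc c x s := by rw [simple_smul_def, simple_smul_def, evalVertex_smul, mul_smul]

theorem idPath_smul_simple (s : H.Simple b) : basisElt (H.idPath b) • s = s := by
  rw [simple_smul_def, evalVertex_basisElt_idPath, one_smul]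

theorem basisElt_smul_simple_of_ne {x : H.Paths} (h : x ≠ H.idPath b) (s : H.Simple b) :
    basisElt x • s = 0 := by
  rw [simple_smul_def, evalVertex_basisElt_of_ne h, zero_smul]

namespace Bar

variable {n : ℕ}

/-- The augmentation of the bar resolution. -/
def aug : H.Bar b 0 →ₗ[H.Alg] H.Simple b :=
  liftAlg (fun c => basisElt (c 0) • H.simpleOne b)
    (fun x c h => by rw [smul_smul, basisElt_mul h, Chain.act_apply])
    (fun x c h => by rw [smul_smul, basisElt_mul_of_ne h, zero_smul])

/-- The differential of the bar resolution. -/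
def diff (n : ℕ) : H.Bar b (n + 1) →ₗ[H.Alg] H.Bar b n :=
  liftAlg (fun c => ∑ j : Fin (n + 1), (-1 : k) ^ (j : ℕ) • gen (c.face j))
    (fun x c h => by
      rw [Finset.smul_sum]
      refine Finset.sum_congr rfl fun j _ => ?_
      rw [smul_comm, basisElt_smul_gen (h.trans (c.tail_face j).symm), Chain.face_act])
    (fun x c h => by
      rw [Finset.smul_sum]
      refine Finset.sum_eq_zero fun j _ => ?_
      rw [smul_comm, basisElt_smul_gen_of_ne, smul_zero]
      rwa [Chain.tail_face])

variable {H b}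

theorem aug_gen (c : H.Chain b 0) : aug H b (gen c) = basisElt (c 0) • H.simpleOne b :=
  liftAlg_gen _ _ _ c

theorem aug_gen_of_not_isBased {c : H.Chain b 0} (h : ¬ c.IsBased) : aug H b (gen c) = 0 := by
  rw [aug_gen]
  refine basisElt_smul_simple_of_ne H b (fun h' => h ?_) _
  rw [Chain.IsBased, h']; rfl

theorem aug_gen_of_isBased {c : H.Chain b 0} (h : c.IsBased) :
    aug H b (gen c) = H.simpleOne b := by
  rw [aug_gen, Chain.eq_idPath_of_isBased h, idPath_smul_simple]

theorem diff_gen (c : H.Chain b (n + 1)) :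
    diff H b n (gen c) = ∑ j : Fin (n + 1), (-1 : k) ^ (j : ℕ) • gen (c.face j) :=
  liftAlg_gen _ _ _ c

variable (H b) in
/-- The chain `e_b`. -/
def baseChain : H.Chain b 0 where
  toFun _ := H.idPath b
  strictMono := fun i j h => by omega
  head_last := rfl

variable (H b) in
/-- The `k`-linear section of the augmentation. -/
def coaug : H.Simple b →ₗ[k] H.Bar b 0 :=
  (LinearMap.toSpanSingleton k (H.Bar b 0) (gen (baseChain H b))).comp
    (ULift.moduleEquiv (R := k) (M := k)).toLinearMap

theorem coaug_simpleOne : coaug H b (H.simpleOne b) = gen (baseChain H b) :=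
  one_smul k (gen (baseChain H b))

theorem aug_coaug (s : H.Simple b) : aug H b (coaug H b s) = s := by
  conv_rhs => rw [← H.smul_simpleOne b s]
  exact ((aug H b).map_smul_of_tower s.down (gen (baseChain H b))).trans
    (by rw [aug_gen_of_isBased (c := baseChain H b) rfl])

open Classical in
variable (H b) in
/-- The contracting homotopy of the bar resolution. -/
def homotopy (n : ℕ) : H.Bar b n →ₗ[k] H.Bar b (n + 1) :=
  lift fun c => if h : c.IsBased then 0 else gen (c.cons h)

theorem homotopy_gen {c : H.Chain b n} (h : ¬ c.IsBased) :
    homotopy H b n (gen c) = gen (c.cons h) := by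
  rw [homotopy, lift_gen, dif_neg h]

theorem homotopy_gen_of_isBased {c : H.Chain b n} (h : c.IsBased) :
    homotopy H b n (gen c) = 0 := by
  rw [homotopy, lift_gen, dif_pos h]

/-- The only based chain with one element is `e_b`, which is what `coaug ∘ aug` retains; any other
one-element chain is the zeroth face of its extension by a trivial path. -/
theorem diff_homotopy_zero (m : H.Bar b 0) :
    diff H b 0 (homotopy H b 0 m) + coaug H b (aug H b m) = m := by
  have key : (diff H b 0).restrictScalars k ∘ₗ homotopy H b 0 +
      coaug H b ∘ₗ (aug H b).restrictScalars k = LinearMap.id := hom_ext fun c => by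
    rw [LinearMap.add_apply, LinearMap.comp_apply, LinearMap.comp_apply,
      LinearMap.restrictScalars_apply, LinearMap.restrictScalars_apply, LinearMap.id_apply]
    by_cases h : c.IsBased
    · rw [homotopy_gen_of_isBased h, map_zero, zero_add, aug_gen_of_isBased h, coaug_simpleOne]
      exact congrArg gen (Chain.ext_apply fun i => by
        rw [Fin.fin_one_eq_zero i, Chain.eq_idPath_of_isBased h]; rfl)
    · rw [homotopy_gen h, aug_gen_of_not_isBased h, map_zero, add_zero, diff_gen,
        Fin.sum_univ_one, Chain.face_zero_cons, Fin.val_zero, pow_zero, one_smul]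
  exact LinearMap.congr_fun key m

/-- For a based chain the homotopy vanishes on it and on every face but the zeroth, from which
prepending restores the chain. For other chains, prepending commutes with faces up to an index
shift, so all terms but the zeroth cancel in pairs. -/
theorem diff_homotopy_succ (n : ℕ) (m : H.Bar b (n + 1)) :
    diff H b (n + 1) (homotopy H b (n + 1) m) + homotopy H b n (diff H b n m) = m := by
  have key : (diff H b (n + 1)).restrictScalars k ∘ₗ homotopy H b (n + 1) +
      homotopy H b n ∘ₗ (diff H b n).restrictScalars k = LinearMap.id := hom_ext fun c => by
    rw [LinearMap.add_apply, LinearMap.comp_apply, LinearMap.comp_apply,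
      LinearMap.restrictScalars_apply, LinearMap.restrictScalars_apply, LinearMap.id_apply,
      diff_gen, map_sum]
    by_cases h : c.IsBased
    · rw [homotopy_gen_of_isBased h, map_zero, zero_add, Fin.sum_univ_succ, Fin.val_zero,
        pow_zero, one_smul, homotopy_gen c.face_zero_not_isBased, Chain.cons_face_zero h]
      refine (congrArg _ (Finset.sum_eq_zero fun j _ => ?_)).trans (add_zero _)
      -- The index `j` in `Fin n` forces `n` to be positive, so deleting a later element still
      -- leaves the trivial path at the bottom.
      obtain ⟨n, rfl⟩ : ∃ l, n = l + 1 := ⟨n - 1, by have := j.pos; omega⟩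
      rw [map_smul, homotopy_gen_of_isBased (Chain.face_succ_isBased h j), smul_zero]
    · rw [homotopy_gen h, diff_gen, Fin.sum_univ_succ, Chain.face_zero_cons, Fin.val_zero,
        pow_zero, one_smul, add_assoc, ← Finset.sum_add_distrib]
      refine (congrArg _ (Finset.sum_eq_zero fun j _ => ?_)).trans (add_zero _)
      rw [map_smul, homotopy_gen (Chain.face_not_isBased h j), Chain.face_succ_cons h,
        ← add_smul, Fin.val_succ, pow_succ, mul_neg_one, neg_add_cancel, zero_smul]
  exact LinearMap.congr_fun key m

/-- An `A`-linear map on the bar resolution vanishes if it does so on the image of the contracting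
homotopy. -/
theorem eq_zero_of_homotopy {M : Type*} [AddCommGroup M] [Module H.Alg M]
    (f : H.Bar b (n + 1) →ₗ[H.Alg] M) (hf : ∀ m, f (homotopy H b n m) = 0)
    (m : H.Bar b (n + 1)) : f m = 0 := by
  -- Every chain is `c_0` times a based chain, and a based chain with at least two elements is
  -- obtained by prepending the trivial path to its zeroth face. So the image of the homotopy
  -- generates over `A`.
  have key : ∀ c, f (gen c) = 0 := fun c => by
    have h := c.strip_isBased
    rw [← basisElt_smul_gen_strip, map_smul, ← Chain.cons_face_zero h, ← homotopy_gen, hf,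
      smul_zero]
  induction m using Bar.induction with
  | zero => exact map_zero f
  | add x y hx hy => rw [map_add, hx, hy, add_zero]
  | smul r c =>
    rw [← one_smul H.Alg (gen c), ← smul_assoc, map_smul, key, smul_zero]

theorem aug_diff (m : H.Bar b 1) : aug H b (diff H b 0 m) = 0 := by
  refine eq_zero_of_homotopy (aug H b ∘ₗ diff H b 0) (fun m => ?_) m
  rw [LinearMap.comp_apply, eq_sub_of_add_eq (diff_homotopy_zero m), map_sub, aug_coaug, sub_self]

/-- No simplicial identities are needed: on the image of the homotopy `h`, one has `d d h = d - d h
d = h d d`, which vanishes by induction; the base case rests on `aug_diff`. -/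
theorem diff_diff (n : ℕ) (m : H.Bar b (n + 2)) : diff H b n (diff H b (n + 1) m) = 0 := by
  refine eq_zero_of_homotopy (diff H b n ∘ₗ diff H b (n + 1)) (fun m => ?_) m
  rw [LinearMap.comp_apply, eq_sub_of_add_eq (diff_homotopy_succ n m), map_sub]
  cases n with
  | zero =>
    rw [eq_sub_of_add_eq (diff_homotopy_zero (diff H b 0 m)), aug_diff, map_zero, sub_zero,
      sub_self]
  | succ n =>
    rw [eq_sub_of_add_eq (diff_homotopy_succ n (diff H b (n + 1) m)), diff_diff n, map_zero,
      sub_zero, sub_self]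

/-- The canonical surjection from the free module on the elements of `B_n` is split by `c ↦ c_0 ·
[strip c]`; this map is `A`-linear because stripping ignores left multiplication. -/
instance : Module.Projective H.Alg (H.Bar b n) := by
  let s : H.Bar b n →ₗ[H.Alg] (H.Bar b n →₀ H.Alg) :=
    liftAlg (fun c => Finsupp.single (gen c.strip) (basisElt (c 0)))
      (fun x c h => by
        rw [Finsupp.smul_single, smul_eq_mul, basisElt_mul h, Chain.strip_act, Chain.act_apply])
      (fun x c h => by
        rw [Finsupp.smul_single, smul_eq_mul, basisElt_mul_of_ne h, Finsupp.single_zero])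
  refine ⟨s, fun m => ?_⟩
  have key : (Finsupp.linearCombination H.Alg id ∘ₗ s).restrictScalars k =
      LinearMap.id (M := H.Bar b n) := hom_ext fun c => by
    rw [LinearMap.restrictScalars_apply, LinearMap.comp_apply, LinearMap.id_apply, liftAlg_gen,
      Finsupp.linearCombination_single, id, basisElt_smul_gen_strip]
  exact LinearMap.congr_fun key m

end Bar

/-! ### The projective resolution -/

/-- The bar resolution of `S_b` as a chain complex. -/
def barComplex : ChainComplex (ModuleCat.{max u v w} H.Alg) ℕ :=
  ChainComplex.of (fun n => ModuleCat.of H.Alg (H.Bar b n))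
    (fun n => ModuleCat.ofHom (Bar.diff H b n))
    (fun n => ModuleCat.hom_ext (LinearMap.ext (Bar.diff_diff n)))

theorem barComplex_d (n : ℕ) : (H.barComplex b).d (n + 1) n = ModuleCat.ofHom (Bar.diff H b n) :=
  ChainComplex.of_d (fun n => ModuleCat.of H.Alg (H.Bar b n))
    (fun n => ModuleCat.ofHom (Bar.diff H b n)) n

/-- The bar resolution of `S_b` is a projective resolution. -/
def barResolution : ProjectiveResolution (ModuleCat.of H.Alg (H.Simple b)) where
  complex := H.barComplex b
  projective n := inferInstanceAs (Projective (ModuleCat.of H.Alg (H.Bar b n)))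
  π := (ChainComplex.toSingle₀Equiv (H.barComplex b) (ModuleCat.of H.Alg (H.Simple b))).symm
    ⟨ModuleCat.ofHom (Bar.aug H b), by
      rw [barComplex_d]
      exact ModuleCat.hom_ext (LinearMap.ext Bar.aug_diff)⟩
  quasiIso := by
    refine ⟨fun n => ?_⟩
    cases n with
    | zero =>
      rw [ChainComplex.quasiIsoAt₀_iff, ShortComplex.quasiIso_iff_of_zeros' _ rfl rfl rfl]
      constructor
      -- A cycle is the boundary of its image under the contracting homotopy; the same argument
      -- serves in positive degrees.
      · refine (ShortComplex.moduleCat_exact_iff _).2 fun (x : H.Bar b 0) hx => ?_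
        refine ⟨(Bar.homotopy H b 0 x : H.Bar b 1), ?_⟩
        have hx' : Bar.aug H b x = 0 := by
          simpa [ChainComplex.toSingle₀Equiv] using! hx
        have h := Bar.diff_homotopy_zero x
        rw [hx', map_zero, add_zero] at h
        refine Eq.trans ?_ h
        exact congrArg (fun f : (H.barComplex b).X 1 ⟶ (H.barComplex b).X 0 =>
          f.hom (Bar.homotopy H b 0 x)) (H.barComplex_d b 0)
      · refine (ModuleCat.epi_iff_surjective _).2 fun (s : H.Simple b) =>
          ⟨(Bar.coaug H b s : H.Bar b 0), ?_⟩
        refine Eq.trans ?_ (Bar.aug_coaug s)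
        simp [ChainComplex.toSingle₀Equiv]
        rfl
    | succ n =>
      rw [quasiIsoAt_iff_exactAt' (hL := ChainComplex.exactAt_succ_single_obj ..),
        HomologicalComplex.exactAt_iff' _ (n + 2) (n + 1) n (by simp) (by simp)]
      refine (ShortComplex.moduleCat_exact_iff _).2 fun (x : H.Bar b (n + 1)) hx => ?_
      have hx' : Bar.diff H b n x = 0 := by
        refine Eq.trans ?_ hx
        exact congrArg (fun f : (H.barComplex b).X (n + 1) ⟶ (H.barComplex b).X n => f.hom x)
          (H.barComplex_d b n).symm
      refine ⟨(Bar.homotopy H b (n + 1) x : H.Bar b (n + 2)), ?_⟩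
      have h := Bar.diff_homotopy_succ n x
      rw [hx', map_zero, add_zero] at h
      refine Eq.trans ?_ h
      exact congrArg (fun f : (H.barComplex b).X (n + 2) ⟶ (H.barComplex b).X (n + 1) =>
          f.hom (Bar.homotopy H b (n + 1) x)) (H.barComplex_d b (n + 1))

end HPA

namespace HPA

variable {k : Type u} [CommRing k] {Q : Type v} [Quiver.{w} Q] [Fintype Q]
  [AcyclicQuiver Q] (H : HPA k Q) (a b : Q)

/-! ### The tensor product of a simple module with the bar resolution -/

/-- The open interval between `e_a` and the path class `p`. -/
abbrev Interval {H : HPA k Q} {a b : Q} (p : H.PathClass a b) : Type (max v w) :=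
  Set.Ioo (H.idPath a) (⟨a, b, p⟩ : H.Paths)

/-! ### Chains starting at `e_a` and simplices of open intervals -/

namespace Chain

variable {H a b} {m : ℕ}

theorem exists_topClass (c : H.Chain b m) (h : c 0 = H.idPath a) :
    ∃ p : H.PathClass a b, (⟨a, b, p⟩ : H.Paths) = c (Fin.last m) := by
  have h1 : (c (Fin.last m)).tail = a := by rw [c.tail_eq, h]; rfl
  have h2 := c.head_last
  generalize c (Fin.last m) = x at h1 h2 ⊢
  subst h1 h2
  exact ⟨x.cls, rfl⟩

/-- The top element of a chain that starts with `e_a`. -/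
def topClass (c : H.Chain b m) (h : c 0 = H.idPath a) : H.PathClass a b :=
  (c.exists_topClass h).choose

theorem mk_topClass (c : H.Chain b m) (h : c 0 = H.idPath a) :
    (⟨a, b, c.topClass h⟩ : H.Paths) = c (Fin.last m) :=
  (c.exists_topClass h).choose_spec

theorem topClass_eq {c : H.Chain b m} (h : c 0 = H.idPath a) {p : H.PathClass a b}
    (hp : (⟨a, b, p⟩ : H.Paths) = c (Fin.last m)) : c.topClass h = p := by
  have := (c.mk_topClass h).trans hp.symm
  simpa using this

/-- The elements of a chain other than the first and the last one. -/
def middle (c : H.Chain b (m + 1)) (h : c 0 = H.idPath a) : Fin m ↪o Interval (c.topClass h) :=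
  OrderEmbedding.ofStrictMono
    (fun i => ⟨c i.succ.castSucc, by
      rw [← h]; exact c.strictMono (Fin.lt_def.2 (Nat.succ_pos _)), by
      rw [mk_topClass]; exact c.strictMono (Fin.castSucc_lt_last _)⟩)
    (fun i j hij => c.strictMono (Fin.castSucc_lt_castSucc_iff.2 (Fin.succ_lt_succ_iff.2 hij)))

theorem middle_apply (c : H.Chain b (m + 1)) (h : c 0 = H.idPath a) (i : Fin m) :
    (c.middle h i : H.Paths) = c i.succ.castSucc := rfl

/-- The chain obtained from a chain in the open interval between `e_a` and `p` by adding both end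
points. -/
def ofInterval {p : H.PathClass a b} (hp : H.idPath a < ⟨a, b, p⟩) (y : Fin m ↪o Interval p) :
    H.Chain b (m + 1) where
  toFun := Fin.cons (H.idPath a)
    (Fin.snoc (α := fun _ => H.Paths) (fun i => (y i : H.Paths)) ⟨a, b, p⟩)
  strictMono := by
    refine Fin.strictMono_iff_lt_succ.2 fun i => ?_
    cases i using Fin.lastCases with
    | last =>
      rw [Fin.cons_succ, Fin.snoc_last]
      cases m with
      -- Without middle elements the two end points are adjacent, and only the hypothesis compares
      -- them.
      | zero => exact hp
      | succ m =>
        rw [← Fin.succ_last, ← Fin.succ_castSucc, Fin.cons_succ, Fin.snoc_castSucc]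
        exact (y _).2.2
    | cast i =>
      rw [Fin.cons_succ, Fin.snoc_castSucc]
      cases m with
      | zero => exact i.elim0
      | succ m =>
        cases i using Fin.cases with
        | zero => exact (y _).2.1
        | succ i =>
          rw [← Fin.succ_castSucc, ← Fin.succ_castSucc, Fin.cons_succ, Fin.snoc_castSucc]
          exact y.strictMono (Fin.castSucc_lt_succ (i := i))
  head_last := by
    rw [← Fin.succ_last, Fin.cons_succ, Fin.snoc_last]

section ofInterval

variable {p : H.PathClass a b} (hp : H.idPath a < ⟨a, b, p⟩) (y : Fin m ↪o Interval p)

theorem ofInterval_zero : ofInterval hp y 0 = H.idPath a := rfl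

theorem ofInterval_last : ofInterval hp y (Fin.last (m + 1)) = ⟨a, b, p⟩ := by
  change Fin.snoc (α := fun _ => H.Paths) (fun i => (y i : H.Paths)) ⟨a, b, p⟩ (Fin.last m) = _
  rw [Fin.snoc_last]

theorem ofInterval_middle (i : Fin m) : ofInterval hp y i.succ.castSucc = y i := by
  change Fin.snoc (α := fun _ => H.Paths) (fun i => (y i : H.Paths)) ⟨a, b, p⟩ i.castSucc = _
  rw [Fin.snoc_castSucc]

end ofInterval

theorem idPath_lt_topClass (c : H.Chain b (m + 1)) (h : c 0 = H.idPath a) :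
    H.idPath a < ⟨a, b, c.topClass h⟩ := by
  rw [mk_topClass, ← h]
  exact c.strictMono (Fin.last_pos)

theorem ofInterval_middle_eq (c : H.Chain b (m + 1)) (h : c 0 = H.idPath a) :
    ofInterval (c.idPath_lt_topClass h) (c.middle h) = c := by
  refine ext_apply fun i => ?_
  cases i using Fin.lastCases with
  | last => rw [ofInterval_last, mk_topClass]
  | cast i =>
    cases i using Fin.cases with
    | zero => exact h.symm
    | succ i => rw [ofInterval_middle, middle_apply]

theorem face_ne_idPath {c : H.Chain b (m + 1)} (h : c 0 ≠ H.idPath a) (j : Fin (m + 1)) :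
    c.face j 0 ≠ H.idPath a := fun h' =>
  h (Paths.eq_idPath_of_le (h' ▸ c.zero_le _))

theorem face_zero_ne_idPath (c : H.Chain b (m + 1)) : c.face 0 0 ≠ H.idPath a := fun h =>
  c.face_zero_not_isBased (by rw [IsBased, h]; rfl)

theorem topClass_face_succ {c : H.Chain b (m + 2)} (h : c 0 = H.idPath a) (j : Fin (m + 1))
    (h' : c.face j.succ 0 = H.idPath a) : (c.face j.succ).topClass h' = c.topClass h := by
  refine topClass_eq h' ?_
  rw [mk_topClass, face_apply, Fin.succAbove_ne_last_last (Fin.castSucc_lt_last _).ne]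

theorem middle_face_succ {c : H.Chain b (m + 2)} (h : c 0 = H.idPath a) (j : Fin (m + 1))
    (h' : c.face j.succ 0 = H.idPath a) (i : Fin m) :
    ((c.face j.succ).middle h' i : H.Paths) = HomotopyPath.face j (c.middle h) i := by
  rw [middle_apply, face_apply, Fin.castSucc_succAbove_castSucc, Fin.succ_succAbove_succ]
  rfl

end Chain

/-! ### Identification of the tensor product with interval chains -/

/-- The sum of the reduced chains, on `m` vertices, of the intervals between `e_a` and the path
classes from `a` to `b`. -/
abbrev IntervalChains (m : ℕ) : Type (max u v w) :=
  (Σ p : H.PathClass a b, Fin m ↪o Interval p) →₀ k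

variable {H a b} {m : ℕ}

/-- The basis elements of the module of interval chains. -/
def intervalGen (p : H.PathClass a b) (y : Fin m ↪o Interval p) : H.IntervalChains a b m :=
  Finsupp.single ⟨p, y⟩ 1

/-- Top classes of a chain and its faces agree only propositionally, so simplices of their intervals
are compared elementwise in `Path_A`. -/
theorem intervalGen_congr {p p' : H.PathClass a b} {y : Fin m ↪o Interval p}
    {y' : Fin m ↪o Interval p'} (hp : p = p') (hy : ∀ i, (y i : H.Paths) = y' i) :
    intervalGen p y = intervalGen p' y' := by
  subst hp
  congr 1
  exact RelEmbedding.ext fun i => Subtype.ext (hy i)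

theorem intervalChains_hom_ext {M : Type*} [AddCommGroup M] [Module k M]
    {f g : H.IntervalChains a b m →ₗ[k] M}
    (h : ∀ p y, f (intervalGen p y) = g (intervalGen p y)) : f = g :=
  Finsupp.lhom_ext' fun y => LinearMap.ext_ring (h y.1 y.2)

variable (H a b m) in
/-- The sum of the boundary maps of the intervals. -/
def intervalBoundary : H.IntervalChains a b (m + 1) →ₗ[k] H.IntervalChains a b m :=
  Finsupp.linearCombination k fun z =>
    ∑ i : Fin (m + 1), (-1 : k) ^ (i : ℕ) • intervalGen z.1 (face i z.2)

theorem intervalBoundary_gen (p : H.PathClass a b) (y : Fin (m + 1) ↪o Interval p) :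
    intervalBoundary H a b m (intervalGen p y) =
      ∑ i : Fin (m + 1), (-1 : k) ^ (i : ℕ) • intervalGen p (face i y) := by
  rw [intervalBoundary, intervalGen, Finsupp.linearCombination_single, one_smul]

open Classical in
variable (H a b m) in
/-- The map sending a chain `e_a < y_1 < ⋯ < y_m < p` to `y_1 < ⋯ < y_m` and all chains with another
first element to zero. -/
def toInterval : H.Bar b (m + 1) →ₗ[k] H.IntervalChains a b m :=
  Bar.lift fun c => if h : c 0 = H.idPath a then intervalGen (c.topClass h) (c.middle h) else 0

theorem toInterval_gen {c : H.Chain b (m + 1)} (h : c 0 = H.idPath a) :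
    toInterval H a b m (Bar.gen c) = intervalGen (c.topClass h) (c.middle h) := by
  rw [toInterval, Bar.lift_gen, dif_pos h]

theorem toInterval_gen_of_ne {c : H.Chain b (m + 1)} (h : c 0 ≠ H.idPath a) :
    toInterval H a b m (Bar.gen c) = 0 := by
  rw [toInterval, Bar.lift_gen, dif_neg h]

/-- This is the balancing condition that lets `toInterval` descend to `S_a ⊗_A B`. -/
theorem toInterval_smul (x : H.Alg) (z : H.Bar b (m + 1)) :
    toInterval H a b m (x • z) = H.evalVertex a x • toInterval H a b m z := by
  induction x using alg_induction with
  | zero => rw [zero_smul, map_zero, map_zero, zero_smul]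
  | add x y hx hy => rw [add_smul, map_add, map_add, hx, hy, add_smul]
  | smul r x =>
    rw [smul_assoc, map_smul, evalVertex_smul, mul_smul, Bar.basisElt_smul]
    congr 1
    refine LinearMap.congr_fun (f := toInterval H a b m ∘ₗ Bar.rep x)
      (g := H.evalVertex a (basisElt x) • toInterval H a b m) (Bar.hom_ext fun c => ?_) z
    rw [LinearMap.comp_apply, LinearMap.smul_apply]
    by_cases hx : x = H.idPath a
    · subst hx
      rw [evalVertex_basisElt_idPath, one_smul]
      by_cases h : a = (c 0).tail
      · rw [Bar.rep_gen (x := H.idPath a) h]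
        exact congrArg (fun c => toInterval H a b m (Bar.gen c))
          (Chain.ext_apply fun i => Paths.idPath_mul (h.trans (c.tail_eq i).symm))
      · rw [Bar.rep_gen_of_ne (x := H.idPath a) h, map_zero, toInterval_gen_of_ne]
        intro h'
        rw [h'] at h
        exact h rfl
    · rw [evalVertex_basisElt_of_ne hx, zero_smul]
      by_cases h : x.head = (c 0).tail
      · rw [Bar.rep_gen h, toInterval_gen_of_ne]
        intro h'
        rw [Chain.act_apply] at h'
        -- Since `x ≤ x c_0`, a product equal to `e_a` would force `x = e_a`.
        refine hx (Paths.eq_idPath_of_le (h' ▸ ?_))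
        exact Paths.le_iff.2 ⟨_, h, rfl⟩
      · rw [Bar.rep_gen_of_ne h, map_zero]

/-- The zeroth face no longer starts at `e_a` and dies. Face `j + 1` deletes middle vertex `j`, and
this shift of the index produces the sign. -/
theorem toInterval_diff (z : H.Bar b (m + 2)) :
    toInterval H a b m (Bar.diff H b (m + 1) z) =
      -intervalBoundary H a b m (toInterval H a b (m + 1) z) := by
  refine LinearMap.congr_fun
    (f := toInterval H a b m ∘ₗ (Bar.diff H b (m + 1)).restrictScalars k)
    (g := -(intervalBoundary H a b m ∘ₗ toInterval H a b (m + 1))) (Bar.hom_ext fun c => ?_) z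
  rw [LinearMap.comp_apply, LinearMap.restrictScalars_apply, LinearMap.neg_apply,
    LinearMap.comp_apply, Bar.diff_gen, map_sum]
  by_cases h : c 0 = H.idPath a
  · rw [toInterval_gen h, intervalBoundary_gen, Fin.sum_univ_succ, map_smul,
      toInterval_gen_of_ne c.face_zero_ne_idPath, smul_zero, zero_add, ← Finset.sum_neg_distrib]
    refine Finset.sum_congr rfl fun j _ => ?_
    have h' : c.face j.succ 0 = H.idPath a := by rw [Chain.face_succ_zero, h]
    rw [map_smul, toInterval_gen h', Fin.val_succ, pow_succ, mul_neg_one, neg_smul,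
      intervalGen_congr (Chain.topClass_face_succ h j h') (Chain.middle_face_succ h j h')]
  · rw [toInterval_gen_of_ne h, map_zero, neg_zero]
    refine Finset.sum_eq_zero fun j _ => ?_
    rw [map_smul, toInterval_gen_of_ne (Chain.face_ne_idPath h j), smul_zero]

open TensorProduct

variable (H a b m) in
/-- The map from `S_a ⊗_A B_{m + 1}`, for the bar resolution `B`, to the interval chains. -/
def tensorToInterval :
    TensorOver k H.Alg (H.Simple a) (H.Bar b (m + 1)) →ₗ[k] H.IntervalChains a b m :=
  Submodule.liftQ _
    (TensorProduct.AlgebraTensorModule.lift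
      ((LinearMap.toSpanSingleton k (H.Bar b (m + 1) →ₗ[ℤ] H.IntervalChains a b m)
        (toInterval H a b m).toAddMonoidHom.toIntLinearMap).comp
          (ULift.moduleEquiv (R := k) (M := k)).toLinearMap)) (by
      refine Submodule.span_le.2 ?_
      rintro _ ⟨s, x, z, rfl⟩
      refine LinearMap.mem_ker.2 ?_
      rw [map_sub, sub_eq_zero]
      change (H.evalVertex a x * s.down) • toInterval H a b m z =
        s.down • toInterval H a b m (x • z)
      rw [toInterval_smul, smul_smul, mul_comm])

theorem tensorToInterval_tmul (s : H.Simple a) (z : H.Bar b (m + 1)) :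
    tensorToInterval H a b m (Submodule.Quotient.mk (s ⊗ₜ[ℤ] z)) =
      s.down • toInterval H a b m z := rfl

theorem tensorToInterval_diff (t : TensorOver k H.Alg (H.Simple a) (H.Bar b (m + 2))) :
    tensorToInterval H a b m
        (TensorOver.map k H.Alg (H.Simple a) (Bar.diff H b (m + 1)) t) =
      -intervalBoundary H a b m (tensorToInterval H a b (m + 1) t) := by
  refine LinearMap.congr_fun
    (f := tensorToInterval H a b m ∘ₗ
      TensorOver.map k H.Alg (H.Simple a) (Bar.diff H b (m + 1)))
    (g := -(intervalBoundary H a b m ∘ₗ tensorToInterval H a b (m + 1)))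
    (TensorOver.hom_ext k H.Alg (H.Simple a) fun s z => ?_) t
  rw [LinearMap.comp_apply, LinearMap.neg_apply, LinearMap.comp_apply, TensorOver.map_mk_tmul,
    tensorToInterval_tmul, tensorToInterval_tmul, toInterval_diff, map_smul, smul_neg]

theorem smul_mk_tmul {A : Type*} [Ring A] {N M : Type*} [AddCommGroup N] [Module k N]
    [Module Aᵐᵒᵖ N] [SMulCommClass k Aᵐᵒᵖ N] [AddCommGroup M] [Module A M] (n : N) (x : A)
    (z : M) : (Submodule.Quotient.mk (n ⊗ₜ[ℤ] (x • z)) : TensorOver k A N M) =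
      Submodule.Quotient.mk ((MulOpposite.op x • n) ⊗ₜ[ℤ] z) :=
  ((Submodule.Quotient.eq (balancing k A N M)).2 (Submodule.subset_span ⟨n, x, z, rfl⟩)).symm

open Classical in
variable (H a b m) in
/-- The inverse of `tensorToInterval`. -/
def intervalToTensor :
    H.IntervalChains a b m →ₗ[k] TensorOver k H.Alg (H.Simple a) (H.Bar b (m + 1)) :=
  Finsupp.linearCombination k fun z =>
    -- The default is taken for `p = e_a`: its interval is empty and has an empty simplex when `m =
    -- 0`, but there is no chain `e_a < e_a`.
    if hp : H.idPath a < (⟨a, b, z.1⟩ : H.Paths) then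
      Submodule.Quotient.mk (H.simpleOne a ⊗ₜ[ℤ] Bar.gen (Chain.ofInterval hp z.2))
    else 0

theorem intervalToTensor_gen {p : H.PathClass a b} (hp : H.idPath a < ⟨a, b, p⟩)
    (y : Fin m ↪o Interval p) : intervalToTensor H a b m (intervalGen p y) =
      Submodule.Quotient.mk (H.simpleOne a ⊗ₜ[ℤ] Bar.gen (Chain.ofInterval hp y)) := by
  rw [intervalToTensor, intervalGen, Finsupp.linearCombination_single,
    one_smul, dif_pos hp]

theorem intervalToTensor_tensorToInterval
    (t : TensorOver k H.Alg (H.Simple a) (H.Bar b (m + 1))) :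
    intervalToTensor H a b m (tensorToInterval H a b m t) = t := by
  refine LinearMap.congr_fun (f := intervalToTensor H a b m ∘ₗ tensorToInterval H a b m)
    (g := LinearMap.id) (TensorOver.hom_ext k H.Alg (H.Simple a) fun s z => ?_) t
  rw [LinearMap.comp_apply, LinearMap.id_apply, tensorToInterval_tmul, map_smul]
  have hs : ∀ z : H.Bar b (m + 1), (Submodule.Quotient.mk (s ⊗ₜ[ℤ] z) :
      TensorOver k H.Alg (H.Simple a) (H.Bar b (m + 1))) =
      s.down • Submodule.Quotient.mk (H.simpleOne a ⊗ₜ[ℤ] z) := fun z => by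
    rw [← Submodule.Quotient.mk_smul, TensorProduct.smul_tmul', smul_simpleOne]
  rw [hs]
  congr 1
  induction z using Bar.induction with
  | zero => rw [map_zero, map_zero, TensorProduct.tmul_zero, Submodule.Quotient.mk_zero]
  | add x y hx hy =>
    rw [map_add, map_add, hx, hy, TensorProduct.tmul_add, Submodule.Quotient.mk_add]
  | smul r c =>
    -- The tensor product is formed over `ℤ` and gets its `k`-structure from `S_a`. A scalar on the
    -- right crosses over as the element `r • 1` of `A`, which acts on `S_a` as `r`.
    have h1 : (Submodule.Quotient.mk (H.simpleOne a ⊗ₜ[ℤ] (r • Bar.gen c)) :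
        TensorOver k H.Alg (H.Simple a) (H.Bar b (m + 1))) =
        r • Submodule.Quotient.mk (H.simpleOne a ⊗ₜ[ℤ] Bar.gen c) := by
      rw [← one_smul H.Alg (Bar.gen c), ← smul_assoc, smul_mk_tmul, simple_op_smul_def,
        evalVertex_smul, map_one, mul_one, one_smul, ← TensorProduct.smul_tmul',
        Submodule.Quotient.mk_smul]
    rw [h1, map_smul, map_smul]
    congr 1
    by_cases h : c 0 = H.idPath a
    · rw [toInterval_gen h, intervalToTensor_gen (c.idPath_lt_topClass h),
        Chain.ofInterval_middle_eq]
    -- The nontrivial path `c_0` is split off and moved to `S_a`, where it acts as zero.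
    · rw [toInterval_gen_of_ne h, map_zero, ← Bar.basisElt_smul_gen_strip, smul_mk_tmul,
        simple_op_smul_def, evalVertex_basisElt_of_ne h, zero_smul, TensorProduct.zero_tmul,
        Submodule.Quotient.mk_zero]

/-- At least one vertex is required: it lies between `e_a` and `p` and so witnesses `e_a < p`. -/
theorem tensorToInterval_intervalToTensor (z : H.IntervalChains a b (m + 1)) :
    tensorToInterval H a b (m + 1) (intervalToTensor H a b (m + 1) z) = z := by
  refine LinearMap.congr_fun
    (f := tensorToInterval H a b (m + 1) ∘ₗ intervalToTensor H a b (m + 1))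
    (g := LinearMap.id) (intervalChains_hom_ext fun p y => ?_) z
  have hp : H.idPath a < ⟨a, b, p⟩ := (y 0).2.1.trans (y 0).2.2
  rw [LinearMap.comp_apply, LinearMap.id_apply, intervalToTensor_gen hp, tensorToInterval_tmul,
    toInterval_gen (Chain.ofInterval_zero hp y)]
  refine (one_smul k _).trans (intervalGen_congr ?_ fun i => ?_)
  · exact Chain.topClass_eq _ (Chain.ofInterval_last hp y).symm
  · rw [Chain.middle_apply, Chain.ofInterval_middle]

end HPA

/-! ### Homology of direct sums -/

/-- Two surjective linear maps that identify the same elements have isomorphic targets. -/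
theorem nonempty_equiv_of_surjective {k M A B : Type*} [Semiring k] [AddCommMonoid M] [Module k M]
    [AddCommMonoid A] [Module k A] [AddCommMonoid B] [Module k B] (F : M →ₗ[k] A) (G : M →ₗ[k] B)
    (hF : Function.Surjective F) (hG : Function.Surjective G)
    (h : ∀ x y, F x = F y ↔ G x = G y) : Nonempty (A ≃ₗ[k] B) := by
  have key : ∀ x, G (Function.surjInv hF (F x)) = G x := fun x =>
    (h _ _).1 (Function.surjInv_eq hF _)
  let φ : A →ₗ[k] B :=
    { toFun := fun a => G (Function.surjInv hF a)
      map_add' := fun a a' => by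
        rw [← map_add, ← h, map_add, Function.surjInv_eq hF, Function.surjInv_eq hF,
          Function.surjInv_eq hF]
      map_smul' := fun r a => by
        rw [RingHom.id_apply, ← map_smul, ← h, map_smul, Function.surjInv_eq hF,
          Function.surjInv_eq hF] }
  refine ⟨LinearEquiv.ofBijective φ ⟨fun a a' haa' => ?_, fun z => ?_⟩⟩
  · have := (h _ _).2 haa'
    rwa [Function.surjInv_eq hF, Function.surjInv_eq hF] at this
  · obtain ⟨x, rfl⟩ := hG z
    exact ⟨F x, key x⟩

/-- If the middle term of a complex of modules decomposes as a direct sum, compatibly with kernels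
and images, then the homology decomposes as well. -/
theorem nonempty_quotient_equiv_directSum {k : Type*} [CommRing k] {ι : Type*} {X Y Z : Type*}
    [AddCommGroup X] [Module k X] [AddCommGroup Y] [Module k Y] [AddCommGroup Z] [Module k Z]
    {U V W : ι → Type*} [∀ p, AddCommGroup (U p)] [∀ p, Module k (U p)]
    [∀ p, AddCommGroup (V p)] [∀ p, Module k (V p)] [∀ p, AddCommGroup (W p)]
    [∀ p, Module k (W p)] (g : Y →ₗ[k] Z) (f : X →ₗ[k] LinearMap.ker g)
    (g' : ∀ p, V p →ₗ[k] W p) (f' : ∀ p, U p →ₗ[k] LinearMap.ker (g' p))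
    (e : Y ≃ₗ[k] DirectSum ι V)
    (hker : ∀ x, g x = 0 ↔ ∀ p, g' p (e x p) = 0)
    (hrange : ∀ x, (∃ y, (f y : Y) = x) ↔ ∀ p, ∃ y, (f' p y : V p) = e x p) :
    Nonempty ((LinearMap.ker g ⧸ LinearMap.range f) ≃ₗ[k]
      DirectSum ι fun p => LinearMap.ker (g' p) ⧸ LinearMap.range (f' p)) := by
  classical
  let K := fun p => LinearMap.ker (g' p)
  let incl : (DirectSum ι fun p => K p) →ₗ[k] DirectSum ι V :=
    DirectSum.lmap fun p => (K p).subtype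
  let F₀ : (DirectSum ι fun p => K p) →ₗ[k] LinearMap.ker g :=
    LinearMap.codRestrict _ (e.symm.toLinearMap ∘ₗ incl) fun z => by
      refine LinearMap.mem_ker.2 ((hker _).2 fun p => ?_)
      rw [LinearMap.comp_apply, LinearEquiv.coe_coe, LinearEquiv.apply_symm_apply]
      exact (z p).2
  have hF₀ : ∀ z p, e (F₀ z).1 p = (z p).1 := fun z p =>
    congrArg (fun y : DirectSum ι V => y p) (e.apply_symm_apply (incl z))
  -- Both sides are quotients of the direct sum of the kernels of the `g' p`, through `F` and `G`,
  -- so it remains to see that these identify the same elements.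
  let F := (LinearMap.range f).mkQ ∘ₗ F₀
  let G : (DirectSum ι fun p => K p) →ₗ[k] DirectSum ι fun p => K p ⧸ LinearMap.range (f' p) :=
    DirectSum.lmap fun p => (LinearMap.range (f' p)).mkQ
  have hG : Function.Surjective G :=
    (DirectSum.lmap_surjective _).2 fun p => Submodule.mkQ_surjective _
  have hF : Function.Surjective F := by
    refine (Submodule.mkQ_surjective _).comp fun x => ?_
    -- All components of `e x` lie in the kernels by `hker`; the default `0` only makes the map
    -- total.
    refine ⟨DFinsupp.mapRange (fun p v => if h : v ∈ K p then (⟨v, h⟩ : K p) else 0)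
      (fun p => dif_pos (zero_mem _)) (e x.1), Subtype.ext (e.injective ?_)⟩
    refine DFinsupp.ext fun p => (hF₀ _ p).trans ?_
    have h : e x.1 p ∈ K p := (hker x.1).1 x.2 p
    refine (congrArg Subtype.val (DFinsupp.mapRange_apply _ _ _ p)).trans ?_
    rw [dif_pos h]
  refine nonempty_equiv_of_surjective F G hF hG fun x y => ?_
  have h1 : F x = F y ↔ ∃ u, (f u : Y) = ((F₀ x - F₀ y : LinearMap.ker g) : Y) := by
    refine (Submodule.Quotient.eq (LinearMap.range f)).trans ?_
    rw [LinearMap.mem_range]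
    exact exists_congr fun u => Subtype.ext_iff
  have h2 : G x = G y ↔ ∀ p, ∃ u, (f' p u : V p) = ((x p - y p : K p) : V p) := by
    refine DFinsupp.ext_iff.trans (forall_congr' fun p => ?_)
    refine (Submodule.Quotient.eq (LinearMap.range (f' p))).trans ?_
    rw [LinearMap.mem_range]
    exact exists_congr fun u => Subtype.ext_iff
  rw [h1, h2, hrange]
  refine forall_congr' fun p => ?_
  have h3 : e ((F₀ x - F₀ y : LinearMap.ker g) : Y) p = ((x p - y p : K p) : V p) := by
    rw [Submodule.coe_sub, map_sub, Submodule.coe_sub, ← hF₀, ← hF₀]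
    rfl
  rw [h3]

/-- The homology of a short complex that decomposes as a direct sum in its middle term, compatibly
with kernels and images, is the direct sum of the homologies. -/
theorem nonempty_homology_equiv_directSum {k : Type u} [CommRing k] {ι : Type v}
    (S : ShortComplex (ModuleCat.{w} k)) (T : ι → ShortComplex (ModuleCat.{w} k))
    (e : S.X₂ ≃ₗ[k] DirectSum ι fun p => (T p).X₂)
    (hker : ∀ x, S.g x = 0 ↔ ∀ p, (T p).g (e x p) = 0)
    (hrange : ∀ x, (∃ y, S.f y = x) ↔ ∀ p, ∃ y, (T p).f y = e x p) :
    Nonempty (S.homology ≃ₗ[k] DirectSum ι fun p => (T p).homology) := by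
  obtain ⟨φ⟩ := nonempty_quotient_equiv_directSum S.g.hom S.moduleCatToCycles
    (fun p => (T p).g.hom) (fun p => (T p).moduleCatToCycles) e hker hrange
  exact ⟨S.moduleCatHomologyIso.toLinearEquiv ≪≫ₗ φ ≪≫ₗ
    (DirectSum.congrLinearEquiv fun p => (T p).moduleCatHomologyIso.toLinearEquiv).symm⟩

/-! ### Splitting the complex over path classes and computing `Tor` -/

namespace HPA

variable {k : Type u} [CommRing k] {Q : Type v} [Quiver.{w} Q] [Fintype Q]
  [AcyclicQuiver Q] {H : HPA k Q} {a b : Q} {m : ℕ}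

variable (H a b m) in
/-- Interval chains as a direct sum. -/
def intervalEquiv : H.IntervalChains a b m ≃ₗ[k]
    DirectSum (H.PathClass a b) fun p => ReducedChains k (Interval p) m :=
  open Classical in
  sigmaFinsuppLequivDFinsupp k

theorem intervalEquiv_boundary (z : H.IntervalChains a b (m + 1)) (p : H.PathClass a b) :
    intervalEquiv H a b m (intervalBoundary H a b m z) p =
      boundary k (Interval p) m (intervalEquiv H a b (m + 1) z p) := by
  classical
  let F (m : ℕ) : H.IntervalChains a b m →ₗ[k] ReducedChains k (Interval p) m :=
    DirectSum.component k (H.PathClass a b) (fun p => ReducedChains k (Interval p) m) p ∘ₗ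
      (intervalEquiv H a b m).toLinearMap
  have hF (m : ℕ) (q : H.PathClass a b) (y : Fin m ↪o Interval q) (h : q ≠ p) :
      F m (intervalGen q y) = 0 := Finsupp.ext fun y' =>
    Finsupp.single_eq_of_ne (fun e => h (congrArg Sigma.fst e).symm)
  have hF' (m : ℕ) (y : Fin m ↪o Interval p) : F m (intervalGen p y) = Finsupp.single y 1 :=
    Finsupp.ext fun y' => (Finsupp.single_apply ..).trans
      ((if_congr (by simp) rfl rfl).trans (Finsupp.single_apply ..).symm)
  refine LinearMap.congr_fun (f := F m ∘ₗ intervalBoundary H a b m)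
    (g := boundary k (Interval p) m ∘ₗ F (m + 1)) (intervalChains_hom_ext fun q y => ?_) z
  clear_value F
  rw [LinearMap.comp_apply, LinearMap.comp_apply, intervalBoundary_gen, map_sum]
  by_cases h : q = p
  · subst h
    rw [hF', boundary_single]
    refine Finset.sum_congr rfl fun i _ => ?_
    rw [map_smul, hF', one_smul, Finsupp.smul_single, smul_eq_mul, mul_one]
  · rw [hF _ _ _ h, map_zero]
    exact Finset.sum_eq_zero fun i _ => by rw [map_smul, hF _ _ _ h, smul_zero]

theorem tensorToInterval_injective : Function.Injective (tensorToInterval H a b m) :=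
  Function.LeftInverse.injective intervalToTensor_tensorToInterval

theorem tensorToInterval_surjective : Function.Surjective (tensorToInterval H a b (m + 1)) :=
  Function.RightInverse.surjective tensorToInterval_intervalToTensor

variable (H a b m) in
/-- The tensor product of `S_a` with the bar resolution of `S_b`, in positive degree, as a direct
sum. -/
def tensorEquiv : TensorOver k H.Alg (H.Simple a) (H.Bar b (m + 2)) ≃ₗ[k]
    DirectSum (H.PathClass a b) fun p => ReducedChains k (Interval p) (m + 1) :=
  LinearEquiv.ofBijective (tensorToInterval H a b (m + 1))
    ⟨tensorToInterval_injective, tensorToInterval_surjective⟩ ≪≫ₗ intervalEquiv H a b (m + 1)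

/-- The target degree may have `m = 0`, where `tensorToInterval` need not be onto; for kernels its
injectivity is enough. -/
theorem map_diff_eq_zero_iff (t : TensorOver k H.Alg (H.Simple a) (H.Bar b (m + 2))) :
    TensorOver.map k H.Alg (H.Simple a) (Bar.diff H b (m + 1)) t = 0 ↔
      ∀ p, boundary k (Interval p) m (tensorEquiv H a b m t p) = 0 := by
  have h : ∀ p, boundary k (Interval p) m (tensorEquiv H a b m t p) = intervalEquiv H a b m
      (intervalBoundary H a b m (tensorToInterval H a b (m + 1) t)) p := fun p =>
    (intervalEquiv_boundary _ p).symm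
  rw [← map_eq_zero_iff _ (tensorToInterval_injective (H := H) (a := a) (b := b) (m := m)),
    tensorToInterval_diff, neg_eq_zero, ← (intervalEquiv H a b m).map_eq_zero_iff]
  exact DFinsupp.ext_iff.trans (forall_congr' fun p => by rw [h]; rfl)

/-- For images the source must be identified fully, which is possible as its simplices have `m + 2`
vertices. -/
theorem exists_map_diff_eq_iff (t : TensorOver k H.Alg (H.Simple a) (H.Bar b (m + 2))) :
    (∃ u, TensorOver.map k H.Alg (H.Simple a) (Bar.diff H b (m + 2)) u = t) ↔
      ∀ p, ∃ z, boundary k (Interval p) (m + 1) z = tensorEquiv H a b m t p := by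
  classical
  have h : ∀ u p, boundary k (Interval p) (m + 1) (tensorEquiv H a b (m + 1) u p) =
      -tensorEquiv H a b m (TensorOver.map k H.Alg (H.Simple a) (Bar.diff H b (m + 2)) u) p :=
    fun u p => by
      refine (intervalEquiv_boundary _ p).symm.trans ?_
      refine Eq.trans ?_ (congrArg (fun z => -intervalEquiv H a b (m + 1) z p)
        (tensorToInterval_diff u).symm)
      rw [map_neg]
      exact (neg_neg _).symm
  constructor
  · rintro ⟨u, rfl⟩ p
    exact ⟨-tensorEquiv H a b (m + 1) u p, by rw [map_neg, h, neg_neg]⟩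
  · intro ht
    -- The componentwise preimages can be assembled into one element of the direct sum.
    have hr : tensorEquiv H a b m t ∈
        LinearMap.range (DirectSum.lmap fun p => boundary k (Interval p) (m + 1)) := by
      rw [DirectSum.range_lmap]
      exact fun p _ => ht p
    obtain ⟨z, hz⟩ := hr
    -- The minus sign compensates the one in `tensorToInterval_diff`.
    refine ⟨(tensorEquiv H a b (m + 1)).symm (-z), (tensorEquiv H a b m).injective ?_⟩
    refine DFinsupp.ext fun p => ?_
    rw [← hz, ← neg_inj]
    refine (h _ p).symm.trans ?_
    rw [LinearEquiv.apply_symm_apply]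
    exact map_neg _ _

variable (H a b) in
/-- `Tor` of simple modules in degree at least `2`, computed by open intervals of `Path_A`. -/
theorem nonempty_tor_equiv (n : ℕ) :
    Nonempty (TorOver k H.Alg (H.Simple a) (n + 2) (ModuleCat.of H.Alg (H.Simple b)) ≃ₗ[k]
      DirectSum (H.PathClass a b) fun p => reducedHomology k (Interval p) n) := by
  let F := tensorFunctor k H.Alg (H.Simple a)
  let C := (F.mapHomologicalComplex _).obj (H.barComplex b)
  let R (p : H.PathClass a b) := reducedComplex k (Interval p)
  -- The chains of `B_{n+2}` have `n + 3` elements, hence `n + 1` middle ones: degree `n + 2` here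
  -- matches degree `n + 1` of the reduced complexes, that is, dimension `n`.
  let e₁ : TorOver k H.Alg (H.Simple a) (n + 2) (ModuleCat.of H.Alg (H.Simple b)) ≅
      (C.sc' (n + 3) (n + 2) (n + 1)).homology :=
    (H.barResolution b).isoLeftDerivedObj F (n + 2) ≪≫
      C.homologyIsoSc' (n + 3) (n + 2) (n + 1) (by simp) (by simp)
  let e₂ (p : H.PathClass a b) : reducedHomology k (Interval p) n ≅
      ((R p).sc' (n + 2) (n + 1) n).homology :=
    (R p).homologyIsoSc' (n + 2) (n + 1) n (by simp) (by simp)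
  have hC : ∀ m, C.d (m + 1) m =
      ModuleCat.ofHom (TensorOver.map k H.Alg (H.Simple a) (Bar.diff H b m)) := fun m =>
    congrArg F.map (H.barComplex_d b m)
  have hR : ∀ p m, (R p).d (m + 1) m = ModuleCat.ofHom (boundary k (Interval p) m) := fun p m =>
    ChainComplex.of_d (fun m => ModuleCat.of k (ReducedChains k (Interval p) m))
      (fun m => ModuleCat.ofHom (boundary k (Interval p) m)) m
  obtain ⟨e⟩ := nonempty_homology_equiv_directSum (C.sc' (n + 3) (n + 2) (n + 1))
    (fun p => (R p).sc' (n + 2) (n + 1) n) (tensorEquiv H a b n)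
    (fun x => by
      change C.d (n + 2) (n + 1) x = 0 ↔ ∀ p, (R p).d (n + 1) n _ = 0
      simp only [hC, hR]
      exact map_diff_eq_zero_iff x)
    (fun x => by
      change (∃ y, C.d (n + 3) (n + 2) y = x) ↔ ∀ p, ∃ y, (R p).d (n + 2) (n + 1) y = _
      simp only [hC, hR]
      exact exists_map_diff_eq_iff x)
  exact ⟨e₁.toLinearEquiv ≪≫ₗ e ≪≫ₗ
    (DirectSum.congrLinearEquiv fun p => (e₂ p).toLinearEquiv).symm⟩

end HPA

end HomotopyPath

end

theorem mainTheorem12 {k : Type u} [CommRing k] {Q : Type v} [Quiver.{w} Q] [Fintype Q]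
    [∀ a b : Q, Finite (a ⟶ b)] [HomotopyPath.AcyclicQuiver Q] (H : HomotopyPath.HPA k Q)
    (a b : Q) (i : ℕ) (hi : 2 ≤ i) :
    Nonempty
      (HomotopyPath.TorOver k H.Alg (H.Simple a) i (ModuleCat.of H.Alg (H.Simple b)) ≃ₗ[k]
        DirectSum (H.PathClass a b) fun p =>
          HomotopyPath.reducedHomology k
            (Set.Ioo (H.idPath a) (⟨a, b, p⟩ : H.Paths)) (i - 2)) := by
  obtain ⟨n, rfl⟩ := Nat.exists_eq_add_of_le' hi
  exact HomotopyPath.HPA.nonempty_tor_equiv H a b n
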